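/- Let $c$ be a positive integer and $d=2c$. Let $R=\mathbb Z[z]$ be the polynomial ring in the $3d+3$ indeterminates $z_{i,j}$ ($0\le i\le d$, $1\le j\le 3$), let $S=R[x,y]$, and let $G_j=\sum_{i=0}^d z_{i,j}x^iy^{d-i}\in S$ for $1\le j\le 3$. For $n\ge 1$ let $M_n$ be the $(d+n)\times 3n$ matrix over $R$ consisting of three blocks of $n$ columns, where column $o$ ($0\le o<n$) of block $j$ is the coefficient vector $(z_{0,j},\dots,z_{d,j})^{\mathrm T}$ preceded by $o$ zeros and followed by $n-1-o$ zeros. Put $w=\det M_c$ and $A=M_{c+1}$, a $(3c+1)\times(3c+3)$ matrix. Let $Z_j$ be the cofactor in $M_c$ of the entry $z_{0,j}$ of the first row, so that $w=z_{0,1}Z_1+z_{0,2}Z_2+z_{0,3}Z_3$. For a column index $p$ of $A$, let $b^{(p)}\in R^{3c+3}$ be the Eagon–Northcott relation on $A$ obtained by crossing out column $p$: its entry in position $p$ is $0$, and its other entries are the maximal minors of the remaining $(3c+1)\times(3c+2)$ matrix, obtained by deleting one further column at a time, with alternating signs $+,-,+,\dots$. Let $N$ be the $3\times(3c+3)$ block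 diagonal matrix with the row $[y^c,xy^{c-1},\dots,x^c]$ in each of its three diagonal blocks. Define matrices over $S$ by $$d_1=[G_1\ G_2\ G_3],\qquad d_2=N\,[\,b^{(1)}\ b^{(c+2)}\ b^{(2c+3)}\,],\qquad d_3=\begin{bmatrix} z_{0,1}\\ (-1)^{c+1}z_{0,2}\\ z_{0,3}\end{bmatrix},$$ and let $d_2^{(j)}$ be $d_2$ with column $j$ removed. For a $3\times2$ matrix $Q$ let $\Phi(Q)=[\,Q_{23},-Q_{13},Q_{12}\,]$, where $Q_{ab}$ is the minor of $Q$ on rows $a<b$. Finally, identify the localization $S_w$ with $R_w[x,y]$, let $\sigma=\frac1w[\,Z_1\ \ (-1)^{c+1}Z_2\ \ Z_3\,]\colon S_w^3\to S_w$, and let $\mathbb{UPR}_{\mathbb Z}$ be $$0\to\ker\sigma\xrightarrow{\ d_2|_{\ker\sigma}\ }S_w^3\xrightarrow{\ d_1\ }S_w .$$ Then the following hold. 1. For $1\le j\le3$, $\Phi(d_2^{(j)})=(-1)^{jc+1}z_{0,j}\,w^2\,d_1$ in $S^3$. 2. The sequence $0\to S_w\xrightarrow{d_3}S_w^3\xrightarrow{d_2}S_w^3\xrightarrow{d_1}S_w\to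 S_w/(G_1,G_2,G_3)\to0$ is exact. 3. The ideal $(G_1,G_2,G_3)$ of $S_w$ is perfect of grade $2$: it is a proper ideal, and both its grade and the projective dimension of $S_w/(G_1,G_2,G_3)$ are equal to $2$. 4. For $1\le j\le3$, the sequence $0\to S_{wz_{0,j}}^2\xrightarrow{d_2^{(j)}}S_{wz_{0,j}}^3\xrightarrow{d_1}S_{wz_{0,j}}\to S_{wz_{0,j}}/(G_1,G_2,G_3)\to0$ is exact. 5. The $S_w$-module $\ker\sigma$ is projective (it is not claimed to be free), and $\mathbb{UPR}_{\mathbb Z}$ is a projective resolution of $S_w/(G_1,G_2,G_3)$. 6. $\mathbb{UPR}_{\mathbb Z}$ is a universal projective resolution for the graded Betti numbers $0\to B(-3c)^2\to B(-2c)^3\to B$. That is, let $k$ be any field, $B=k[x,y]$ with the standard grading, and let $$0\to B(-3c)^2\xrightarrow{\ \varphi\ }B(-2c)^3\xrightarrow{\ g\ }B\to B/I\to0$$ be any (automatically minimal) homogeneous resolution of a quotient $B/I$ of this form. Then there is a ring homomorphism $\alpha\colon R_w\to k$ such that $\mathbb{UPR}_{\mathbb Z}\otimes_{R_w}k$, where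 $k$ is an $R_w$-module through $\alpha$, is isomorphic to $0\to B(-3c)^2\xrightarrow{\varphi}B(-2c)^3\xrightarrow{g}B$ as a complex of graded $B$-modules, by an isomorphism which is the canonical identification in positions $0$ and $1$. (Here $\ker\sigma$ is graded as a submodule of $S_w(-3c)^3$, with $x,y$ of degree $1$ and $R_w$ in degree $0$.) In particular $\mathbb{UPR}_{\mathbb Z}\otimes_{R_w}k$ is a minimal homogeneous resolution of $B/I$. -/

import Mathlib

open scoped TensorProduct

noncomputable section

namespace UPRZ

/-! ### The generic forms and their coefficient matrices

Throughout, `d = 2 * c`.  Rows, columns and the index `j` of the three forms are numbered from `0`,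
so that `X (i, j) : R c` is the indeterminate usually written `z_{i, j+1}`. -/

/-- The polynomial ring `ℤ[z]` in the `3 d + 3` indeterminates `z_{i,j}`. -/
abbrev R (c : ℕ) : Type := MvPolynomial (Fin (2 * c + 1) × Fin 3) ℤ

/-- The bigraded polynomial ring `ℤ[x, y, z] = ℤ[z][x, y]`, with `x = X 0` and `y = X 1`. -/
abbrev S (c : ℕ) : Type := MvPolynomial (Fin 2) (R c)

/-- The indeterminate `z_{i,j}`. -/
def z (c : ℕ) (i : Fin (2 * c + 1)) (j : Fin 3) : R c := MvPolynomial.X (i, j)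

/-- The generic form `G_j = ∑ i, z_{i,j} x ^ i y ^ (d - i)`. -/
def G (c : ℕ) (j : Fin 3) : S c :=
  ∑ i : Fin (2 * c + 1), MvPolynomial.C (z c i j) *
    (MvPolynomial.X 0 ^ (i : ℕ) * MvPolynomial.X 1 ^ (2 * c - (i : ℕ)))

/-- The entry in row `r` and column `s` of the `(d + n) × 3 n` band matrix in which each form
contributes `n` columns: the `o`-th column of the `j`-th block is the coefficient vector of `G_j`,
shifted down by `o`. -/
def entry (c n r s : ℕ) : R c :=
  if h : s % n ≤ r ∧ r - s % n < 2 * c + 1 ∧ s / n < 3 then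
    z c ⟨r - s % n, h.2.1⟩ ⟨s / n, h.2.2⟩
  else 0

/-- The square matrix `A^{(c-1)}` (each form contributes `c` columns). -/
def Asq (c : ℕ) : Matrix (Fin (3 * c)) (Fin (3 * c)) (R c) :=
  Matrix.of fun r s => entry c c r s

/-- `w = det A^{(c-1)}`. -/
def w (c : ℕ) : R c := (Asq c).det

/-- The `(3 c + 1) × (3 c + 3)` matrix `A = A^{(c)}` (each form contributes `c + 1` columns). -/
def A (c : ℕ) : Matrix (Fin (3 * c + 1)) (Fin (3 * c + 3)) (R c) :=
  Matrix.of fun r s => entry c (c + 1) r s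

/-- The Eagon–Northcott relation on `A` which belongs to the column `p`: cross out column `p` of `A`
and take the signed maximal minors of the remaining `(3 c + 1) × (3 c + 2)` matrix; the entry in
position `p` is `0`. -/
def b (c : ℕ) (p : Fin (3 * c + 3)) : Fin (3 * c + 3) → R c :=
  Fin.insertNth (α := fun _ => R c) p 0 fun t : Fin (3 * c + 2) =>
    (-1) ^ (t : ℕ) * ((A c).submatrix id fun s => p.succAbove (t.succAbove s)).det

/-- The first column of the `j`-th block of `A`. -/
def firstCol (c : ℕ) (j : Fin 3) : Fin (3 * c + 3) :=
  ⟨(j : ℕ) * (c + 1), by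
    have h : (j : ℕ) * (c + 1) ≤ 2 * (c + 1) := Nat.mul_le_mul_right _ (by omega)
    omega⟩

/-- The `3 × (3 c + 3)` block diagonal matrix `N` with the row `[y ^ c, x y ^ (c-1), …, x ^ c]` in
each diagonal block. -/
def N (c : ℕ) : Matrix (Fin 3) (Fin (3 * c + 3)) (S c) :=
  Matrix.of fun l s =>
    if (s : ℕ) / (c + 1) = l then
      MvPolynomial.X 0 ^ ((s : ℕ) % (c + 1)) * MvPolynomial.X 1 ^ (c - (s : ℕ) % (c + 1))
    else 0

/-! ### The matrices `d₁`, `d₂`, `d₃` over `ℤ[x, y, z]` -/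

/-- `d₁ = [G₁, G₂, G₃]`. -/
def d1 (c : ℕ) : Fin 3 → S c := G c

/-- `d₂ = [q₁, q₂, q₃]`, where `q_j = N b^{(p)}` and `p` is the first column of block `j`. -/
def d2 (c : ℕ) : Matrix (Fin 3) (Fin 3) (S c) :=
  N c * Matrix.of fun s j => MvPolynomial.C (b c (firstCol c j) s)

/-- `d₂` with column `j` removed. -/
def d2del (c : ℕ) (j : Fin 3) : Matrix (Fin 3) (Fin 2) (S c) :=
  (d2 c).submatrix id j.succAbove

/-- `d₃`, the column `[z_{0,1}, (-1)^{c+1} z_{0,2}, z_{0,3}]`. -/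
def d3 (c : ℕ) : Fin 3 → S c :=
  ![MvPolynomial.C (z c 0 0), (-1) ^ (c + 1) * MvPolynomial.C (z c 0 1), MvPolynomial.C (z c 0 2)]

/-- The signed `2 × 2` minors `[|Q_{23}|, -|Q_{13}|, |Q_{12}|]` of a `3 × 2` matrix. -/
def Phi {T : Type*} [CommRing T] (Q : Matrix (Fin 3) (Fin 2) T) : Fin 3 → T :=
  fun i => (-1) ^ (i : ℕ) * (Q.submatrix i.succAbove id).det

/-! ### Localization -/

/-- The ring `ℤ[z]_f[x, y]`, i.e. `ℤ[x, y, z]` localized at an element `f` of `ℤ[z]`. -/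
abbrev Loc {c : ℕ} (f : R c) : Type := MvPolynomial (Fin 2) (Localization.Away f)

/-- The localization map `ℤ[x, y, z] → ℤ[z]_f[x, y]`. -/
def toLoc {c : ℕ} (f : R c) : S c →+* Loc f :=
  MvPolynomial.map (algebraMap (R c) (Localization.Away f))

/-- The linear form `T³ → T` given by a row vector. -/
def rowMap {T : Type*} [CommRing T] (r : Fin 3 → T) : (Fin 3 → T) →ₗ[T] T :=
  Fintype.linearCombination T r

/-- `d₁` over `ℤ[z]_f[x, y]`. -/
def d1Loc {c : ℕ} (f : R c) : (Fin 3 → Loc f) →ₗ[Loc f] Loc f :=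
  rowMap fun j => toLoc f (d1 c j)

/-- `d₂` over `ℤ[z]_f[x, y]`. -/
def d2Loc {c : ℕ} (f : R c) : (Fin 3 → Loc f) →ₗ[Loc f] (Fin 3 → Loc f) :=
  ((d2 c).map (toLoc f)).mulVecLin

/-- `d₂` with column `j` removed, over `ℤ[z]_f[x, y]`. -/
def d2delLoc {c : ℕ} (f : R c) (j : Fin 3) : (Fin 2 → Loc f) →ₗ[Loc f] (Fin 3 → Loc f) :=
  ((d2del c j).map (toLoc f)).mulVecLin

/-- `d₃` over `ℤ[z]_f[x, y]`. -/
def d3Loc {c : ℕ} (f : R c) : Loc f →ₗ[Loc f] (Fin 3 → Loc f) :=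
  LinearMap.toSpanSingleton (Loc f) (Fin 3 → Loc f) fun j => toLoc f (d3 c j)

/-- The ideal `(G₁, G₂, G₃)` of `ℤ[z]_f[x, y]`. -/
def genericIdeal {c : ℕ} (f : R c) : Ideal (Loc f) :=
  Ideal.span (Set.range fun j => toLoc f (G c j))

/-! ### Resolutions and perfection -/

/-- `0 → P → T³ → T → T / I → 0` is exact. -/
def IsResolutionOfLengthTwo {T P : Type*} [CommRing T] [AddCommMonoid P] [Module T P]
    (f₂ : P →ₗ[T] (Fin 3 → T)) (f₁ : (Fin 3 → T) →ₗ[T] T) (I : Ideal T) : Prop :=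
  Function.Injective f₂ ∧ Function.Exact f₂ f₁ ∧ Function.Exact f₁ (Submodule.mkQ I)

/-- `0 → T → T³ → T³ → T → T / I → 0` is exact. -/
def IsResolutionOfLengthThree {T : Type*} [CommRing T] (f₃ : T →ₗ[T] (Fin 3 → T))
    (f₂ : (Fin 3 → T) →ₗ[T] (Fin 3 → T)) (f₁ : (Fin 3 → T) →ₗ[T] T) (I : Ideal T) : Prop :=
  Function.Injective f₃ ∧ Function.Exact f₃ f₂ ∧ Function.Exact f₂ f₁ ∧
    Function.Exact f₁ (Submodule.mkQ I)

/-- A proper ideal `I` is perfect of grade `n`: both the grade of `I` (the maximal length of a regular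
sequence in `I`) and the projective dimension of `T / I` are equal to `n`. -/
def IsPerfectOfGrade {T : Type*} [CommRing T] (I : Ideal T) (n : ℕ) : Prop :=
  I ≠ ⊤ ∧
  IsGreatest {m : ℕ | ∃ rs : List T, rs.length = m ∧ (∀ r ∈ rs, r ∈ I) ∧
    RingTheory.Sequence.IsRegular T rs} n ∧
  CategoryTheory.projectiveDimension (ModuleCat.of T (T ⧸ I)) = n

/-! ### The complex `UPR` over `ℤ[z]_w[x, y]` -/

/-- The elements `Z₁, Z₂, Z₃`: the cofactors of the entries `z_{0,1}, z_{0,2}, z_{0,3}` in the first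
row of `A^{(c-1)}` (these sit in columns `0`, `c`, `2 c`, all other entries of that row are zero), so
that `w = z_{0,1} Z₁ + z_{0,2} Z₂ + z_{0,3} Z₃` when `c` is positive. -/
def Z (c : ℕ) (j : Fin 3) : R c :=
  (-1) ^ ((j : ℕ) * c) * (Matrix.of fun r s : Fin (3 * c - 1) =>
    entry c c ((r : ℕ) + 1) (if (s : ℕ) < (j : ℕ) * c then (s : ℕ) else (s : ℕ) + 1)).det

/-- The splitting `σ = (1 / w) [Z₁, (-1)^{c+1} Z₂, Z₃]` of `d₃`. -/
def sigma (c : ℕ) : (Fin 3 → Loc (w c)) →ₗ[Loc (w c)] Loc (w c) :=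
  rowMap fun j => MvPolynomial.C (IsLocalization.Away.invSelf (w c) *
    algebraMap (R c) (Localization.Away (w c))
      (![Z c 0, (-1) ^ (c + 1) * Z c 1, Z c 2] j))

/-- The module `ker σ` in position `2` of `UPR`. -/
abbrev UPR₂ (c : ℕ) : Submodule (Loc (w c)) (Fin 3 → Loc (w c)) := LinearMap.ker (sigma c)

/-- The differential of `UPR` from position `2` to position `1`: the restriction of `d₂`. The
differential from position `1` to position `0` is `d1Loc (w c)`. -/
def uprMap₂ (c : ℕ) : UPR₂ c →ₗ[Loc (w c)] (Fin 3 → Loc (w c)) :=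
  (d2Loc (w c)).domRestrict (UPR₂ c)

/-! ### Resolutions over `k[x, y]` and specialization -/

/-- `0 → B(-3c)² --φ--> B(-2c)³ --g--> B → B / I → 0`, with `B = k[x, y]`, is a homogeneous resolution.
For positive `c` it is automatically minimal, as all entries of `φ` and `g` lie in `(x, y)`. -/
structure IsBalancedResolution (c : ℕ) {k : Type*} [Field k] (I : Ideal (MvPolynomial (Fin 2) k))
    (g : Fin 3 → MvPolynomial (Fin 2) k) (φ : Matrix (Fin 3) (Fin 2) (MvPolynomial (Fin 2) k)) :
    Prop where
  homogeneous_g : ∀ i, (g i).IsHomogeneous (2 * c)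
  homogeneous_φ : ∀ i j, (φ i j).IsHomogeneous c
  resolution : IsResolutionOfLengthTwo φ.mulVecLin (rowMap g) I

/-- The tensor product of `UPR` along `α : ℤ[z]_w → k` is isomorphic, as a complex of graded modules
over `B = k[x, y]`, to `B(-3c)² --φ--> B(-2c)³ --g--> B`. The isomorphism is the canonical one in
positions `0` and `1`. In position `2`, the component of `B ⊗ ker σ` of degree `3 c + n` is generated
by the tensors `p ⊗ v` with `p` homogeneous of degree `i`, and with the coordinates of `v`
homogeneous of degree `j` in `x, y`, where `i + j = n`; it corresponds to the component of degree
`3 c + n` of `B(-3c)²`. -/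
def SpecializesTo (c : ℕ) {k : Type*} [Field k] (α : Localization.Away (w c) →+* k)
    (g : Fin 3 → MvPolynomial (Fin 2) k) (φ : Matrix (Fin 3) (Fin 2) (MvPolynomial (Fin 2) k)) :
    Prop :=
  letI : Algebra (Loc (w c)) (MvPolynomial (Fin 2) k) := (MvPolynomial.map α).toAlgebra
  let B := MvPolynomial (Fin 2) k
  ∃ e : (B ⊗[Loc (w c)] UPR₂ c) ≃ₗ[B] (Fin 2 → B),
    (∀ (n : ℕ) (t : B ⊗[Loc (w c)] UPR₂ c),
      t ∈ AddSubgroup.closure {u : B ⊗[Loc (w c)] UPR₂ c | ∃ (i j : ℕ) (p : B) (v : UPR₂ c),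
          i + j = n ∧ p.IsHomogeneous i ∧
          (∀ l, ((v : Fin 3 → Loc (w c)) l).IsHomogeneous j) ∧ u = p ⊗ₜ v} ↔
        ∀ l, (e t l).IsHomogeneous n) ∧
    φ.mulVecLin ∘ₗ e.toLinearMap =
      (TensorProduct.piScalarRight (Loc (w c)) B B (Fin 3)).toLinearMap ∘ₗ
        (uprMap₂ c).baseChange B ∧
    rowMap g ∘ₗ (TensorProduct.piScalarRight (Loc (w c)) B B (Fin 3)).toLinearMap =
      (TensorProduct.AlgebraTensorModule.rid (Loc (w c)) B B).toLinearMap ∘ₗ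
        (d1Loc (w c)).baseChange B

end UPRZ

end

noncomputable section

namespace UPRZ

/-! ### Hilbert–Burch type exactness -/

section HilbertBurch

variable {T : Type*} [CommRing T]

/-! The matrix `M_n` is the matrix of `(f₁, f₂, f₃) ↦ ∑ f_j G_j` from triples of binary forms of
degree `n - 1` to forms of degree `2c + n - 1`. For `n = c` it is square with determinant `w`, so
multiplying by its adjugate puts `w x^(3c-1)` and `w y^(3c-1)` into `(G₁, G₂, G₃)`. Once `w` is a
unit the ideal contains the coprime pair `x^(3c-1)`, `y^(3c-1)`. For `n = c + 1` the relations `b`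
on the columns of `A` become syzygies of degree `c`, the columns of `d₂`.

The minors of two such columns are orthogonal to both of them, as is `G`; coprimality makes the two
vectors proportional (`exists_mul_Phi_eq`). Both have degree `2c`, so the factor lies in `R`, and
setting `x = 0`, `y = 1` identifies it: only the entries of `b` at first columns of blocks survive,
and each is `0` or `± z_{0,m} w` (`b_succAbove`). This gives `Phi_d2del`. Similarly, the combination
of the `b`'s behind `d₂ d₃ = 0` vanishes at the three first columns, and the remaining entries form
a kernel vector of `M_c`, hence vanish.

Where `z_{0,j}` is invertible, a Hilbert–Burch argument shows that `d₂^{(j)}` resolves the ideal.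
Since `w = ∑ z_{0,j} Z_j` is a unit, these charts glue, and `σ` is the partition of unity that does
it. `ExactData` packages this over any domain where `w` becomes invertible, so it serves both the
generic localization and the fibre over a field.

For universality, a kernel vector of the specialized `M_c` would be a nonzero syzygy of degree `c -
1`, while syzygies are generated in degree `c`. So `w` stays nonzero (`coeffHom_w_ne_zero`), and
both resolutions embed their second module onto the same syzygy module (`specializesTo`). -/

theorem Phi_eq (Q : Matrix (Fin 3) (Fin 2) T) :
    Phi Q = ![Q 1 0 * Q 2 1 - Q 1 1 * Q 2 0, -(Q 0 0 * Q 2 1 - Q 0 1 * Q 2 0),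
      Q 0 0 * Q 1 1 - Q 0 1 * Q 1 0] := by
  funext i
  fin_cases i <;> simp [Phi, Matrix.det_fin_two, Fin.succAbove, Fin.lt_def]

theorem rowMap_apply (r v : Fin 3 → T) : rowMap r v = v 0 * r 0 + v 1 * r 1 + v 2 * r 2 := by
  simp [rowMap, Fintype.linearCombination_apply, Fin.sum_univ_three]

theorem Phi_mul_eq_zero {Q : Matrix (Fin 3) (Fin 2) T} {e : Fin 2 → T} (h : Q.mulVec e = 0)
    (i : Fin 3) (l : Fin 2) : Phi Q i * e l = 0 := by
  have h0 := congrFun h 0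
  have h1 := congrFun h 1
  have h2 := congrFun h 2
  simp only [Matrix.mulVec, dotProduct, Fin.sum_univ_two, Pi.zero_apply] at h0 h1 h2
  rw [Phi_eq]
  fin_cases i <;> fin_cases l <;> simp
  · linear_combination Q 2 1 * h1 - Q 1 1 * h2
  · linear_combination Q 1 0 * h2 - Q 2 0 * h1
  · linear_combination Q 0 1 * h2 - Q 2 1 * h0
  · linear_combination Q 2 0 * h0 - Q 0 0 * h2
  · linear_combination Q 1 1 * h0 - Q 0 1 * h1
  · linear_combination Q 0 0 * h1 - Q 1 0 * h0

/-- The minors of `Q` kill every kernel vector, so `h • G` does, and hence so does the nonzero `h *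
a`. -/
theorem mulVec_injective_of_Phi [IsDomain T] {Q : Matrix (Fin 3) (Fin 2) T} {G : Fin 3 → T}
    {h a : T} (hQ : Phi Q = h • G) (hh : h ≠ 0) (ha : a ≠ 0) (haG : ∃ u, rowMap G u = a) :
    Function.Injective Q.mulVecLin := by
  rw [← LinearMap.ker_eq_bot, LinearMap.ker_eq_bot']
  intro e he
  obtain ⟨u, hu⟩ := haG
  rw [rowMap_apply] at hu
  funext l
  have key (i : Fin 3) : h * G i * e l = 0 := by
    have := Phi_mul_eq_zero (Q := Q) (e := e) he i l
    rwa [hQ] at this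
  have : h * a * e l = 0 := by
    rw [← hu]
    linear_combination u 0 * key 0 + u 1 * key 1 + u 2 * key 2
  simpa [hh, ha] using this

theorem exists_mulVec_eq_smul {Q : Matrix (Fin 3) (Fin 2) T} {G v : Fin 3 → T} {h a : T}
    (hQ : Phi Q = h • G) (haG : ∃ u, rowMap G u = a) (hv : rowMap G v = 0) :
    ∃ e, Q.mulVec e = (h * a) • v := by
  obtain ⟨u, hu⟩ := haG
  rw [rowMap_apply] at hu hv
  rw [Phi_eq] at hQ
  have h0 := congrFun hQ 0
  have h1 := congrFun hQ 1
  have h2 := congrFun hQ 2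
  simp at h0 h1 h2
  -- With `t = v × u` and `q₀`, `q₁` the columns of `Q`, the witness gives `Q e = (q₀ × q₁) × t = h
  -- G × (v × u)`. The double cross product formula turns this into `h ((G·u) v - (G·v) u) = h a v`.
  let t : Fin 3 → T := ![v 1 * u 2 - v 2 * u 1, v 2 * u 0 - v 0 * u 2, v 0 * u 1 - v 1 * u 0]
  refine ⟨![-(Q 0 1 * t 0 + Q 1 1 * t 1 + Q 2 1 * t 2),
    Q 0 0 * t 0 + Q 1 0 * t 1 + Q 2 0 * t 2], ?_⟩
  funext i
  fin_cases i <;> simp [Matrix.mulVec, dotProduct, Fin.sum_univ_two, t]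
  · linear_combination (v 0 * u 1 - v 1 * u 0) * h1 - (v 2 * u 0 - v 0 * u 2) * h2
      + h * v 0 * hu - h * u 0 * hv
  · linear_combination (v 1 * u 2 - v 2 * u 1) * h2 - (v 0 * u 1 - v 1 * u 0) * h0
      + h * v 1 * hu - h * u 1 * hv
  · linear_combination (v 2 * u 0 - v 0 * u 2) * h0 - (v 1 * u 2 - v 2 * u 1) * h1
      + h * v 2 * hu - h * u 2 * hv

/-- Preimages `e` of `h a v` and `f` of `h b v` satisfy `b e = a f` by injectivity. Coprimality then
lets the factor `a` be cancelled from `e`. -/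
theorem exists_mulVec_eq_smul_of_coprime [IsDomain T] {Q : Matrix (Fin 3) (Fin 2) T}
    {G v : Fin 3 → T} {h a b : T}
    (hQ : Phi Q = h • G) (hh : h ≠ 0) (ha : a ≠ 0) (haG : ∃ u, rowMap G u = a)
    (hbG : ∃ u, rowMap G u = b) (hab : ∀ s t, b * s = a * t → a ∣ s) (hv : rowMap G v = 0) :
    ∃ e, Q.mulVec e = h • v := by
  obtain ⟨e, he⟩ := exists_mulVec_eq_smul hQ haG hv
  obtain ⟨f, hf⟩ := exists_mulVec_eq_smul hQ hbG hv
  have hef : b • e = a • f := by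
    apply mulVec_injective_of_Phi hQ hh ha haG
    simp only [Matrix.mulVecLin_apply, Matrix.mulVec_smul, he, hf, smul_smul]
    congr 1
    ring
  have hd (l : Fin 2) : a ∣ e l := hab _ _ (congrFun hef l)
  choose e' he' using hd
  refine ⟨e', ?_⟩
  have : a • (Q.mulVec e') = a • (h • v) := by
    rw [← Matrix.mulVec_smul, smul_smul, mul_comm a h, ← he]
    congr 1
    funext l
    simp [he' l]
  exact smul_right_injective _ ha this

theorem range_rowMap (G : Fin 3 → T) : LinearMap.range (rowMap G) = Ideal.span (Set.range G) :=
  Fintype.range_linearCombination T G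

theorem exact_rowMap_mkQ (G : Fin 3 → T) :
    Function.Exact (rowMap G) (Submodule.mkQ (Ideal.span (Set.range G))) := by
  rw [LinearMap.exact_iff, Submodule.ker_mkQ, range_rowMap]

theorem isResolutionOfLengthTwo_of_Phi [IsDomain T] {Q : Matrix (Fin 3) (Fin 2) T}
    {G : Fin 3 → T} {h a b : T}
    (hQ : Phi Q = h • G) (hh : IsUnit h) (ha : a ≠ 0) (haG : ∃ u, rowMap G u = a)
    (hbG : ∃ u, rowMap G u = b) (hab : ∀ s t, b * s = a * t → a ∣ s)
    (hGQ : ∀ e, rowMap G (Q.mulVec e) = 0) :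
    IsResolutionOfLengthTwo Q.mulVecLin (rowMap G) (Ideal.span (Set.range G)) := by
  refine ⟨mulVec_injective_of_Phi hQ hh.ne_zero ha haG, fun v => ⟨fun hv => ?_, ?_⟩,
    exact_rowMap_mkQ G⟩
  · obtain ⟨e, he⟩ := exists_mulVec_eq_smul_of_coprime hQ hh.ne_zero ha haG hbG hab hv
    obtain ⟨r, rfl⟩ := hh
    refine ⟨(↑r⁻¹ : T) • e, ?_⟩
    simp [he, smul_smul]
  · rintro ⟨e, rfl⟩
    exact hGQ e

theorem mulVec_submatrix_succAbove (D : Matrix (Fin 3) (Fin 3) T) (v : Fin 3 → T) (j : Fin 3)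
    (hj : v j = 0) :
    (D.submatrix id j.succAbove).mulVec (fun l => v (j.succAbove l)) = D.mulVec v := by
  funext i
  simp only [Matrix.mulVec, dotProduct, Matrix.submatrix_apply, id]
  rw [Fin.sum_univ_succAbove _ j, hj]
  simp

/-- Hypotheses on `D` which make `0 → T --δ--> T³ --D--> T³ --G--> T` exact and `s` a splitting
of `δ`. -/
structure ExactData (D : Matrix (Fin 3) (Fin 3) T) (G δ s r : Fin 3 → T) (a b : T) : Prop where
  phi : ∀ j : Fin 3, Phi (D.submatrix id j.succAbove) = (r j * δ j) • G
  isUnit_r : ∀ j, IsUnit (r j)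
  comp : ∀ v, rowMap G (D.mulVec v) = 0
  mulVec_δ : D.mulVec δ = 0
  split : rowMap s δ = 1
  ne_zero : a ≠ 0
  mem_a : ∃ u, rowMap G u = a
  mem_b : ∃ u, rowMap G u = b
  coprime : ∀ s t, b * s = a * t → a ∣ s

namespace ExactData

variable {D : Matrix (Fin 3) (Fin 3) T} {G δ s r : Fin 3 → T} {a b : T}

/-- Dropping column `j` shows that `δ j • v` is a value of `D`; the identity `∑ s j * δ j = 1` glues
the three preimages. -/
theorem exists_mulVec_eq [IsDomain T] (H : ExactData D G δ s r a b) {v : Fin 3 → T}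
    (hv : rowMap G v = 0) : ∃ e, D.mulVec e = v := by
  have key (j : Fin 3) : ∃ e, D.mulVec e = δ j • v := by
    by_cases h0 : r j * δ j = 0
    · exact ⟨0, by simp [(mul_eq_zero.mp h0).resolve_left (H.isUnit_r j).ne_zero]⟩
    · obtain ⟨e, he⟩ := exists_mulVec_eq_smul_of_coprime (H.phi j) h0 H.ne_zero H.mem_a H.mem_b
        H.coprime hv
      obtain ⟨q, hq⟩ := H.isUnit_r j
      refine ⟨(↑q⁻¹ : T) • j.insertNth (α := fun _ => T) 0 e, ?_⟩
      rw [Matrix.mulVec_smul, ← mulVec_submatrix_succAbove _ _ j (by simp)]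
      simp only [Fin.insertNth_apply_succAbove]
      rw [he, ← hq, smul_smul, Units.inv_mul_cancel_left]
  choose e he using key
  refine ⟨s 0 • e 0 + s 1 • e 1 + s 2 • e 2, ?_⟩
  have hs := H.split
  rw [rowMap_apply] at hs
  simp only [Matrix.mulVec_add, Matrix.mulVec_smul, he]
  funext i
  simp
  linear_combination v i * hs

/-- The vector `δ j • v - v j • δ` lies in the kernel of `D` and has `j`-th coordinate zero, so it
is killed by `D` without column `j`, which is injective when `δ j ≠ 0`. Contracting the resulting
proportionality with `s` gives the scalar. -/
theorem eq_smul_of_mulVec_eq_zero [IsDomain T] (H : ExactData D G δ s r a b) {v : Fin 3 → T}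
    (hv : D.mulVec v = 0) : v = rowMap s v • δ := by
  have hs := H.split
  rw [rowMap_apply] at hs
  have key (j : Fin 3) (h0 : δ j ≠ 0) : δ j • v = v j • δ := by
    have hinj := mulVec_injective_of_Phi (H.phi j) (mul_ne_zero (H.isUnit_r j).ne_zero h0)
      H.ne_zero H.mem_a
    have hz : (δ j • v - v j • δ) j = 0 := by simp [mul_comm]
    have h1 := mulVec_submatrix_succAbove D _ j hz
    rw [Matrix.mulVec_sub, Matrix.mulVec_smul, Matrix.mulVec_smul, hv, H.mulVec_δ, smul_zero,
      smul_zero, sub_zero, ← Matrix.mulVecLin_apply] at h1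
    have h2 := hinj (h1.trans (map_zero _).symm)
    rw [← sub_eq_zero]
    funext i
    rcases eq_or_ne i j with rfl | hij
    · exact hz
    · obtain ⟨l, rfl⟩ := Fin.exists_succAbove_eq hij
      exact congrFun h2 l
  have key' (j : Fin 3) : δ j • v = v j • δ := by
    by_cases h0 : δ j = 0
    -- A coordinate with `δ j = 0` needs `v j = 0`, which is borrowed from an index where `δ` does
    -- not vanish; one exists because `s` sends `δ` to `1`.
    · obtain ⟨m, hm⟩ : ∃ m, δ m ≠ 0 := by
        by_contra! h
        simp [h] at hs
      have h1 := congrFun (key m hm) j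
      simp [h0, hm] at h1
      simp [h0, h1]
    · exact key j h0
  rw [rowMap_apply]
  funext i
  have k0 := congrFun (key' 0) i
  have k1 := congrFun (key' 1) i
  have k2 := congrFun (key' 2) i
  simp at k0 k1 k2 ⊢
  linear_combination s 0 * k0 + s 1 * k1 + s 2 * k2 - v i * hs

theorem isResolutionOfLengthThree [IsDomain T] (H : ExactData D G δ s r a b) :
    IsResolutionOfLengthThree (LinearMap.toSpanSingleton T (Fin 3 → T) δ) D.mulVecLin (rowMap G)
      (Ideal.span (Set.range G)) := by
  refine ⟨fun p q hpq => ?_, fun v => ⟨fun hv => ⟨_, (H.eq_smul_of_mulVec_eq_zero hv).symm⟩, ?_⟩,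
    fun v => ⟨fun hv => H.exists_mulVec_eq hv, ?_⟩, exact_rowMap_mkQ G⟩
  · have := congrArg (rowMap s) hpq
    simpa [H.split] using this
  · rintro ⟨p, rfl⟩
    simp [H.mulVec_δ]
  · rintro ⟨e, rfl⟩
    exact H.comp e

theorem isResolutionOfLengthTwo_ker [IsDomain T] (H : ExactData D G δ s r a b) :
    IsResolutionOfLengthTwo (D.mulVecLin.domRestrict (LinearMap.ker (rowMap s))) (rowMap G)
      (Ideal.span (Set.range G)) := by
  refine ⟨?_, fun v => ⟨fun hv => ?_, ?_⟩, exact_rowMap_mkQ G⟩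
  · rw [← LinearMap.ker_eq_bot, LinearMap.ker_eq_bot']
    rintro ⟨v, hv⟩ h
    ext1
    have := H.eq_smul_of_mulVec_eq_zero (v := v) h
    rwa [LinearMap.mem_ker.mp hv, zero_smul] at this
  · obtain ⟨e, he⟩ := H.exists_mulVec_eq hv
    refine ⟨⟨e - rowMap s e • δ, ?_⟩, ?_⟩
    · simp [H.split]
    · simp [Matrix.mulVec_sub, Matrix.mulVec_smul, H.mulVec_δ, he]
  · rintro ⟨e, rfl⟩
    exact H.comp e

/-- The projection along `δ`, `v ↦ v - s(v) δ`, does not change `D v`. Besides projectivity, it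
keeps the inclusion of the kernel injective after base change. -/
theorem exists_retraction (H : ExactData D G δ s r a b) :
    ∃ π : (Fin 3 → T) →ₗ[T] LinearMap.ker (rowMap s),
      π ∘ₗ (LinearMap.ker (rowMap s)).subtype = LinearMap.id ∧
        ∀ v, D.mulVec (π v : Fin 3 → T) = D.mulVec v := by
  refine ⟨LinearMap.codRestrict _
    (LinearMap.id - (LinearMap.toSpanSingleton T (Fin 3 → T) δ) ∘ₗ rowMap s) ?_, ?_, ?_⟩
  · intro v
    simp [H.split]
  · ext v : 2
    simp [LinearMap.mem_ker.mp v.2]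
  · intro v
    simp [Matrix.mulVec_sub, Matrix.mulVec_smul, H.mulVec_δ]

theorem projective_ker (H : ExactData D G δ s r a b) :
    Module.Projective T (LinearMap.ker (rowMap s)) :=
  let ⟨_, hπ, _⟩ := H.exists_retraction
  Module.Projective.of_split _ _ hπ

end ExactData
end HilbertBurch

/-! ### Perfection -/

section Perfection

open RingTheory.Sequence CategoryTheory

variable {T : Type*} [CommRing T]

theorem isRegular_pair [IsDomain T] {I : Ideal T} (hI : I ≠ ⊤) {a b : T} (ha : a ≠ 0)
    (haI : a ∈ I) (hbI : b ∈ I) (hab : ∀ s t, b * s = a * t → a ∣ s) : IsRegular T [a, b] := by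
  refine ⟨?_, ?_⟩
  · rw [isWeaklyRegular_cons_iff, isWeaklyRegular_singleton_iff]
    refine ⟨fun x y h => mul_left_cancel₀ ha h, ?_⟩
    rw [isSMulRegular_iff_right_eq_zero_of_smul]
    intro x
    obtain ⟨x, rfl⟩ := Submodule.Quotient.mk_surjective _ x
    intro h
    rw [← Submodule.Quotient.mk_smul, Submodule.Quotient.mk_eq_zero,
      Submodule.mem_smul_pointwise_iff_exists] at h
    obtain ⟨t, -, ht⟩ := h
    obtain ⟨q, rfl⟩ := hab x t ht.symm
    rw [Submodule.Quotient.mk_eq_zero]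
    exact Submodule.smul_mem_pointwise_smul _ _ _ trivial
  · intro h
    apply hI
    rw [eq_top_iff, h, smul_eq_mul, Ideal.mul_top, Ideal.ofList, Ideal.span_le]
    intro r hr
    simp at hr
    rcases hr with rfl | rfl <;> assumption

/-- In the localization at `p` a regular sequence lowers the Krull dimension by its length, and the
nonzero quotient still has dimension at least `0`. -/
theorem length_le_height [IsNoetherianRing T] {p : Ideal T} [p.IsPrime] {rs : List T}
    (hrs : IsRegular T rs) (hp : ∀ r ∈ rs, r ∈ p) : (rs.length : ℕ∞) ≤ p.height := by
  have h1 := hrs.toIsWeaklyRegular.isRegular_of_isLocalization_of_mem (Localization.AtPrime p) p hp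
  have h2 := ringKrullDim_add_length_eq_ringKrullDim_of_isRegular _ h1
  rw [IsLocalization.AtPrime.ringKrullDim_eq_height p (Localization.AtPrime p),
    List.length_map] at h2
  have h3 : (0 : WithBot ℕ∞) ≤ ringKrullDim (Localization.AtPrime p ⧸
      Ideal.ofList (rs.map (algebraMap T (Localization.AtPrime p)))) := by
    have : Nontrivial (Localization.AtPrime p ⧸
      Ideal.ofList (rs.map (algebraMap T (Localization.AtPrime p)))) := by
      rw [Ideal.Quotient.nontrivial_iff]
      intro h
      apply h1.top_ne_smul
      rw [h, smul_eq_mul, Ideal.mul_top]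
    exact ringKrullDim_nonneg_of_nontrivial
  have h4 : ((rs.length : ℕ∞) : WithBot ℕ∞) ≤ p.height := by
    rw [← h2]
    exact le_add_of_nonneg_left h3
  exact_mod_cast h4

/-- A proper ideal containing a coprime pair is not projective. -/
theorem eq_top_of_projective [IsDomain T] {G : Fin 3 → T} {a b : T} (ha : a ≠ 0)
    (haG : ∃ u, rowMap G u = a) (hbG : ∃ u, rowMap G u = b)
    (hab : ∀ s t, b * s = a * t → a ∣ s) [Module.Projective T (Ideal.span (Set.range G))] :
    Ideal.span (Set.range G) = ⊤ := by
  let π : (Fin 3 → T) →ₗ[T] Ideal.span (Set.range G) :=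
    (rowMap G).codRestrict _ fun v => by
      rw [← range_rowMap]
      exact ⟨v, rfl⟩
  have hπ : Function.Surjective π := by
    rintro ⟨x, hx⟩
    rw [← range_rowMap] at hx
    obtain ⟨v, rfl⟩ := hx
    exact ⟨v, rfl⟩
  obtain ⟨f, hf⟩ := Module.projective_lifting_property π LinearMap.id hπ
  obtain ⟨u, hu⟩ := haG
  obtain ⟨u', hu'⟩ := hbG
  -- Here `f` splits the cover of the ideal by `T³`, and `π u`, `π u'` are `a`, `b` as elements of
  -- the ideal. Linearity and coprimality give `f(a) = a t`; applying `G` and cancelling `a` puts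
  -- `1` in the ideal.
  have e1 : b • f (π u) = a • f (π u') := by
    have : b • π u = a • π u' := by
      ext1
      simp [π, hu, hu', mul_comm]
    rw [← map_smul f, ← map_smul f, this]
  have hd (l : Fin 3) : a ∣ f (π u) l := hab _ _ (congrFun e1 l)
  choose t ht using hd
  have e2 : f (π u) = a • t := funext ht
  have e3 : rowMap G (a • t) = a := by
    rw [← e2, ← hu]
    exact congrArg Subtype.val (LinearMap.congr_fun hf (π u))
  rw [map_smul, smul_eq_mul] at e3
  have e4 : rowMap G t = 1 := mul_left_cancel₀ ha (by rw [e3, mul_one])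
  rw [Ideal.eq_top_iff_one, ← e4]
  exact (π t).2

/-- Dimension shifting along `0 → ker g → T³ → I → 0` and `0 → I → T → T/I → 0`, starting from `ker
g ≅ P` projective. -/
theorem hasProjectiveDimensionLT_quotient {T P : Type*} [CommRing T] [AddCommGroup P] [Module T P]
    [Module.Projective T P] {f : P →ₗ[T] (Fin 3 → T)} {g : (Fin 3 → T) →ₗ[T] T} {I : Ideal T}
    (h : IsResolutionOfLengthTwo f g I) :
    HasProjectiveDimensionLT (ModuleCat.of T (T ⧸ I)) 3 := by
  have hI : LinearMap.range g = I := by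
    have := (LinearMap.exact_iff.mp h.2.2)
    rw [← this, Submodule.ker_mkQ]
  subst hI
  have hS₁ := LinearMap.shortExact_shortComplexKer (f := g.rangeRestrict) g.surjective_rangeRestrict
  have hS₂ := LinearMap.shortExact_shortComplexKer
    (f := Submodule.mkQ (LinearMap.range g)) (Submodule.mkQ_surjective _)
  have hk : LinearMap.range f = LinearMap.ker g.rangeRestrict := by
    rw [LinearMap.ker_rangeRestrict, LinearMap.exact_iff.mp h.2.1]
  have : Module.Projective T (LinearMap.ker g.rangeRestrict) :=
    .of_equiv ((LinearEquiv.ofInjective f h.1).trans (LinearEquiv.ofEq _ _ hk))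
  have p₁ : Projective (ModuleCat.of T (LinearMap.ker g.rangeRestrict)) :=
    ModuleCat.projective_of_categoryTheory_projective _
  have p₂ : Projective (ModuleCat.of T (Fin 3 → T)) :=
    ModuleCat.projective_of_categoryTheory_projective _
  have p₃ : Projective (ModuleCat.of T T) :=
    ModuleCat.projective_of_categoryTheory_projective _
  have h₁ : HasProjectiveDimensionLT (ModuleCat.of T (LinearMap.range g)) 2 :=
    (hS₁.hasProjectiveDimensionLT_X₃_iff 0 p₂).mpr
      (projective_iff_hasProjectiveDimensionLT_one.mp p₁)
  refine (hS₂.hasProjectiveDimensionLT_X₃_iff 1 p₃).mpr ?_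
  have e : LinearMap.range g ≃ₗ[T] LinearMap.ker (Submodule.mkQ (LinearMap.range g)) :=
    LinearEquiv.ofEq _ _ (Submodule.ker_mkQ _).symm
  exact hasProjectiveDimensionLT_of_iso e.toModuleIso 2

theorem projective_of_hasProjectiveDimensionLT {T : Type*} [CommRing T] {I : Ideal T}
    (h : HasProjectiveDimensionLT (ModuleCat.of T (T ⧸ I)) 2) : Module.Projective T I := by
  have hS := LinearMap.shortExact_shortComplexKer (f := Submodule.mkQ I)
    (Submodule.mkQ_surjective _)
  have p : Projective (ModuleCat.of T T) :=
    ModuleCat.projective_of_categoryTheory_projective _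
  have h₁ := (hS.hasProjectiveDimensionLT_X₃_iff 0 p).mp h
  have e : LinearMap.ker (Submodule.mkQ I) ≃ₗ[T] I :=
    LinearEquiv.ofEq _ _ (Submodule.ker_mkQ _)
  have p₁ : Projective (ModuleCat.of T (LinearMap.ker (Submodule.mkQ I))) :=
    projective_iff_hasProjectiveDimensionLT_one.mpr h₁
  have : Module.Projective T (LinearMap.ker (Submodule.mkQ I)) :=
    (IsProjective.iff_projective _).mpr p₁
  exact .of_equiv e

/-- The pair `a, b` bounds the grade below and a prime of height at most `2` over the ideal bounds
it above. The resolution bounds the projective dimension above; if it were smaller, the ideal would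
be projective, hence the unit ideal. -/
theorem isPerfectOfGrade_two {T P : Type*} [CommRing T] [IsDomain T] [IsNoetherianRing T]
    [AddCommGroup P] [Module T P] [Module.Projective T P] {f : P →ₗ[T] (Fin 3 → T)}
    {G : Fin 3 → T} {a b : T}
    (hres : IsResolutionOfLengthTwo f (rowMap G) (Ideal.span (Set.range G)))
    (ha : a ≠ 0) (haG : ∃ u, rowMap G u = a) (hbG : ∃ u, rowMap G u = b)
    (hab : ∀ s t, b * s = a * t → a ∣ s) {p : Ideal T} [p.IsPrime] (hp : p.height ≤ 2)
    (hGp : ∀ j, G j ∈ p) : IsPerfectOfGrade (Ideal.span (Set.range G)) 2 := by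
  have hle : Ideal.span (Set.range G) ≤ p := by
    rw [Ideal.span_le]
    rintro _ ⟨j, rfl⟩
    exact hGp j
  have htop : Ideal.span (Set.range G) ≠ ⊤ := fun h =>
    Ideal.IsPrime.ne_top ‹_› (top_le_iff.mp (h ▸ hle))
  refine ⟨htop, ⟨⟨[a, b], rfl, ?_, ?_⟩, ?_⟩, le_antisymm ?_ ?_⟩
  · intro r hr
    rw [← range_rowMap]
    simp at hr
    rcases hr with rfl | rfl <;> assumption
  · refine isRegular_pair htop ha ?_ ?_ hab
    all_goals rw [← range_rowMap]; assumption
  · rintro m ⟨rs, rfl, hrs, hreg⟩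
    exact_mod_cast (length_le_height hreg fun r hr => hle (hrs r hr)).trans hp
  · exact (projectiveDimension_le_iff _ 2).mpr (hasProjectiveDimensionLT_quotient hres)
  · refine (projectiveDimension_ge_iff _ 2).mpr fun h => htop ?_
    have := projective_of_hasProjectiveDimensionLT h
    exact eq_top_of_projective ha haG hbG hab

end Perfection

/-! ### Entries of the band matrices -/

section Entries

theorem entry_add (c n s i : ℕ) (hi : i < 2 * c + 1) (hs : s / n < 3) :
    entry c n (i + s % n) s = z c ⟨i, hi⟩ ⟨s / n, hs⟩ := by
  have h : s % n ≤ i + s % n ∧ i + s % n - s % n < 2 * c + 1 ∧ s / n < 3 :=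
    ⟨by omega, by omega, hs⟩
  rw [entry, dif_pos h]
  simp

theorem entry_zero_mul (c n : ℕ) (hn : 0 < n) (j : Fin 3) : entry c n 0 (j * n) = z c 0 j := by
  have h := entry_add c n (j * n) 0 (by omega) (by rw [Nat.mul_div_cancel _ hn]; exact j.2)
  simp only [Nat.mul_mod_left, zero_add] at h
  rw [h]
  simp [Nat.mul_div_cancel _ hn]

theorem entry_zero_of_mod_ne (c n s : ℕ) (hs : s % n ≠ 0) : entry c n 0 s = 0 := by
  rw [entry, dif_neg]
  omega

/-- Deleting the first row and the first column of each block of `M_{n+1}` leaves `M_n`. -/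
theorem entry_succ_succ (c n r j o : ℕ) (ho : o < n) :
    entry c (n + 1) (r + 1) (j * (n + 1) + o + 1) = entry c n r (j * n + o) := by
  have h1 : (j * (n + 1) + o + 1) % (n + 1) = o + 1 := by
    rw [add_assoc, mul_comm, Nat.mul_add_mod, Nat.mod_eq_of_lt (by omega)]
  have h2 : (j * (n + 1) + o + 1) / (n + 1) = j := by
    rw [add_assoc, mul_comm, Nat.mul_add_div (by omega), Nat.div_eq_of_lt (by omega), add_zero]
  have h3 : (j * n + o) % n = o := by
    rw [mul_comm, Nat.mul_add_mod, Nat.mod_eq_of_lt ho]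
  have h4 : (j * n + o) / n = j := by
    rw [mul_comm, Nat.mul_add_div (by omega), Nat.div_eq_of_lt (by omega), add_zero]
  simp only [entry, h1, h2, h3, h4, Nat.add_sub_add_right, Nat.add_le_add_iff_right]

/-- The position of a column of `Asq c` among the columns of `A c` that are not the first column of
a block. -/
def shiftCol (c : ℕ) (s : Fin (3 * c)) : Fin (3 * c + 3) :=
  ⟨if (s : ℕ) < c then s + 1 else if (s : ℕ) < 2 * c then s + 2 else s + 3, by split_ifs <;> omega⟩

theorem A_succ_shiftCol (c : ℕ) (r s : Fin (3 * c)) :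
    A c r.succ (shiftCol c s) = Asq c r s := by
  simp only [A, Asq, Matrix.of_apply, shiftCol, Fin.val_succ]
  split_ifs with h1 h2
  · simpa using entry_succ_succ c c r 0 s h1
  · obtain ⟨o, ho⟩ := Nat.exists_eq_add_of_le (not_lt.mp h1)
    rw [ho, show c + o + 2 = 1 * (c + 1) + o + 1 by omega, entry_succ_succ _ _ _ _ _ (by omega),
      one_mul]
  · obtain ⟨o, ho⟩ := Nat.exists_eq_add_of_le (not_lt.mp h2)
    have := s.2
    rw [ho, show 2 * c + o + 3 = 2 * (c + 1) + o + 1 by omega, entry_succ_succ _ _ _ _ _ (by omega)]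

theorem shiftCol_injective (c : ℕ) : Function.Injective (shiftCol c) := by
  intro s t h
  have := congrArg Fin.val h
  simp only [shiftCol] at this
  ext
  split_ifs at this <;> omega

theorem exists_firstCol_or_shiftCol (c : ℕ) (s : Fin (3 * c + 3)) :
    (∃ j, s = firstCol c j) ∨ ∃ t, s = shiftCol c t := by
  have hs := s.2
  by_cases h : (s : ℕ) = 0 ∨ (s : ℕ) = c + 1 ∨ (s : ℕ) = 2 * (c + 1)
  · left
    rcases h with h | h | h
    · exact ⟨0, Fin.ext (by simp [firstCol, h])⟩
    · exact ⟨1, Fin.ext (by simp [firstCol, h])⟩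
    · exact ⟨2, Fin.ext (by simp [firstCol, h])⟩
  · right
    by_cases h1 : (s : ℕ) < c + 1
    · refine ⟨⟨s - 1, by omega⟩, Fin.ext ?_⟩
      simp only [shiftCol]
      split_ifs <;> omega
    · by_cases h2 : (s : ℕ) < 2 * (c + 1)
      · refine ⟨⟨s - 2, by omega⟩, Fin.ext ?_⟩
        simp only [shiftCol]
        split_ifs <;> omega
      · refine ⟨⟨s - 3, by omega⟩, Fin.ext ?_⟩
        simp only [shiftCol]
        split_ifs <;> omega

theorem A_zero_firstCol (c : ℕ) (j : Fin 3) : A c 0 (firstCol c j) = z c 0 j :=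
  entry_zero_mul c (c + 1) (by omega) j

theorem A_zero_shiftCol (c : ℕ) (s : Fin (3 * c)) : A c 0 (shiftCol c s) = 0 := by
  simp only [A, Matrix.of_apply, Fin.val_zero]
  apply entry_zero_of_mod_ne
  simp only [shiftCol]
  have := s.2
  split_ifs with h1 h2
  · rw [Nat.mod_eq_of_lt (by omega)]
    omega
  · rw [Nat.mod_eq_sub_mod (by omega), Nat.mod_eq_of_lt (by omega)]
    omega
  · rw [Nat.mod_eq_sub_mod (by omega), Nat.mod_eq_sub_mod (by omega), Nat.mod_eq_of_lt (by omega)]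
    omega

end Entries

/-! ### Determinants -/

section Determinants

theorem det_eq_of_row_zero {K : Type*} [CommRing K] {m : ℕ}
    (M : Matrix (Fin (m + 1)) (Fin (m + 1)) K) (t : Fin (m + 1)) (h : ∀ s, s ≠ t → M 0 s = 0) :
    M.det = (-1) ^ (t : ℕ) * M 0 t * (M.submatrix Fin.succ t.succAbove).det := by
  rw [Matrix.det_succ_row_zero, Finset.sum_eq_single t]
  · intro s _ hs
    simp [h s hs]
  · simp

/-- Natural number indices and a separate size `q` match the minors in `Z`, whose size is the
truncated `3 * c - 1`, without casts between `Fin` types. -/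
theorem det_natCast_expand {K : Type*} [CommRing K] {m q : ℕ} (h : q = m + 1) (f : ℕ → ℕ → K) :
    (Matrix.of fun r s : Fin q => f r s).det = ∑ t : Fin q, (-1) ^ (t : ℕ) * f 0 t *
      (Matrix.of fun r s : Fin m =>
        f ((r : ℕ) + 1) (if (s : ℕ) < t then (s : ℕ) else (s : ℕ) + 1)).det := by
  subst h
  rw [Matrix.det_succ_row_zero]
  refine Finset.sum_congr rfl fun t _ => ?_
  congr 2
  ext r s
  simp only [Matrix.submatrix_apply, Matrix.of_apply, Fin.val_succ, Fin.succAbove, Fin.lt_def,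
    Fin.val_castSucc]
  split_ifs <;> simp

theorem w_eq_sum (c : ℕ) (hc : 0 < c) : w c = ∑ j : Fin 3, z c 0 j * Z c j := by
  rw [w, Asq, det_natCast_expand (m := 3 * c - 1) (by omega) (fun r s => entry c c r s)]
  symm
  refine Finset.sum_of_injOn (fun j : Fin 3 => ⟨j * c, by nlinarith [j.2]⟩) ?_ ?_ ?_ ?_
  · intro i _ j _ h
    simp only [Fin.mk.injEq] at h
    exact Fin.ext (Nat.eq_of_mul_eq_mul_right hc h)
  · simp
  · intro t _ ht
    rw [entry_zero_of_mod_ne, mul_zero, zero_mul]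
    intro h0
    apply ht
    obtain ⟨q, hq⟩ := Nat.dvd_of_mod_eq_zero h0
    have : q < 3 := by
      by_contra hq3
      have := t.2
      have := Nat.mul_le_mul_left c (not_lt.mp hq3)
      omega
    exact ⟨⟨q, this⟩, by simp, Fin.ext (by simp [hq, mul_comm])⟩
  · intro j _
    simp only [entry_zero_mul c c hc, Z]
    ring

theorem w_ne_zero (c : ℕ) : w c ≠ 0 := by
  -- This specializes the three forms to `y^(2c)`, `x^c y^c`, `x^(2c)`, for which `M_c` is the
  -- identity matrix.
  let f : R c →+* ℤ := MvPolynomial.eval₂Hom (RingHom.id ℤ)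
    fun p => if (p.1 : ℕ) = p.2 * c then 1 else 0
  intro h
  have h1 : f (w c) = 1 := by
    rw [w, RingHom.map_det]
    suffices hM : f.mapMatrix (Asq c) = 1 by rw [hM, Matrix.det_one]
    ext r s
    have hd := Nat.div_add_mod (s : ℕ) c
    simp only [RingHom.mapMatrix_apply, Matrix.map_apply, Asq, Matrix.of_apply, entry,
      Matrix.one_apply]
    have hs3 : (s : ℕ) / c < 3 := Nat.div_lt_of_lt_mul (by have := s.2; omega)
    rw [mul_comm] at hd
    split_ifs with h1 h2 h2
    · subst h2
      simp only [f, z, MvPolynomial.coe_eval₂Hom, MvPolynomial.eval₂_X]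
      rw [if_pos (by omega)]
    · simp only [f, z, MvPolynomial.coe_eval₂Hom, MvPolynomial.eval₂_X]
      rw [if_neg]
      intro h3
      exact h2 (Fin.ext (by omega))
    · exfalso
      apply h1
      subst h2
      refine ⟨by omega, ?_, hs3⟩
      have := Nat.mul_le_mul_right c (Nat.le_of_lt_succ hs3)
      omega
    · simp
  rw [h, map_zero] at h1
  exact zero_ne_one h1

/-- The `r`-th coordinate is the Laplace expansion, along its top row, of the square matrix obtained
by putting a second copy of row `r` on top. -/
theorem A_mulVec_b (c : ℕ) (p : Fin (3 * c + 3)) : (A c).mulVec (b c p) = 0 := by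
  funext r
  simp only [Matrix.mulVec, dotProduct, Pi.zero_apply]
  rw [Fin.sum_univ_succAbove _ p]
  simp only [b, Fin.insertNth_apply_same, Fin.insertNth_apply_succAbove, mul_zero, zero_add]
  let B : Matrix (Fin (3 * c + 1)) (Fin (3 * c + 2)) (R c) := (A c).submatrix id p.succAbove
  let M : Matrix (Fin (3 * c + 2)) (Fin (3 * c + 2)) (R c) :=
    Matrix.of (Fin.cons (B r) B)
  have hM : M.det = 0 :=
    Matrix.det_zero_of_row_eq (i := 0) (j := r.succ) (Fin.succ_ne_zero r).symm rfl
  rw [Matrix.det_succ_row_zero] at hM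
  rw [← hM]
  refine Finset.sum_congr rfl fun t _ => ?_
  rw [mul_left_comm, mul_assoc]
  rfl

theorem val_succAbove {n : ℕ} (p : Fin (n + 1)) (t : Fin n) :
    (p.succAbove t : ℕ) = if (t : ℕ) < p then (t : ℕ) else t + 1 := by
  simp only [Fin.succAbove, Fin.lt_def, Fin.val_castSucc]
  split_ifs <;> simp

/-- With two block-initial columns crossed out, the top row has only the entry of the third one,
`z_{0,m}`, possibly nonzero, and the complementary minor is `M_c`. Here `t` and `t'` are the
positions of the second and third such column among those still present, which fixes the sign. -/
theorem b_succAbove (c : ℕ) (p : Fin (3 * c + 3)) (t : Fin (3 * c + 2)) (t' : Fin (3 * c + 1))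
    (m : Fin 3) (hm : p.succAbove (t.succAbove t') = firstCol c m)
    (h : ∀ s, p.succAbove (t.succAbove (t'.succAbove s)) = shiftCol c s) :
    b c p (p.succAbove t) = (-1) ^ (t : ℕ) * (-1) ^ (t' : ℕ) * (z c 0 m * w c) := by
  have hdet : (((A c).submatrix id fun s => p.succAbove (t.succAbove s)).submatrix Fin.succ
      t'.succAbove) = Asq c := by
    ext1 r s
    simp only [Matrix.submatrix_apply, id, h]
    exact A_succ_shiftCol c r s
  simp only [b, Fin.insertNth_apply_succAbove]
  rw [det_eq_of_row_zero _ t', hdet]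
  · simp only [Matrix.submatrix_apply, id, hm, A_zero_firstCol, w]
    ring
  · intro s hs
    obtain ⟨s, rfl⟩ := Fin.exists_succAbove_eq hs
    simp only [Matrix.submatrix_apply, id, h, A_zero_shiftCol]

theorem b_firstCol_self (c : ℕ) (j : Fin 3) : b c (firstCol c j) (firstCol c j) = 0 := by
  simp [b]

/-- The column bookkeeping is unfolded to inequalities between natural numbers, so that each of the
six pairs of blocks reduces to linear arithmetic. -/
theorem b_firstCol_of (c : ℕ) {j l m : Fin 3} (t t' : ℕ) (ht : t < 3 * c + 2) (ht' : t' < 3 * c + 1)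
    (hl : (if t < (j : ℕ) * (c + 1) then t else t + 1) = l * (c + 1))
    (hm : (if (if t' < t then t' else t' + 1) < (j : ℕ) * (c + 1) then
      (if t' < t then t' else t' + 1) else (if t' < t then t' else t' + 1) + 1) = m * (c + 1))
    (h : ∀ s < 3 * c, (if (if (if s < t' then s else s + 1) < t then (if s < t' then s else s + 1)
      else (if s < t' then s else s + 1) + 1) < (j : ℕ) * (c + 1) then
        (if (if s < t' then s else s + 1) < t then (if s < t' then s else s + 1)
          else (if s < t' then s else s + 1) + 1) else
        (if (if s < t' then s else s + 1) < t then (if s < t' then s else s + 1)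
          else (if s < t' then s else s + 1) + 1) + 1) =
      if s < c then s + 1 else if s < 2 * c then s + 2 else s + 3) :
    b c (firstCol c j) (firstCol c l) = (-1) ^ t * (-1) ^ t' * (z c 0 m * w c) := by
  have h1 := b_succAbove c (firstCol c j) ⟨t, ht⟩ ⟨t', ht'⟩ m
    (Fin.ext (by simp only [val_succAbove, firstCol]; exact hm))
    (fun s => Fin.ext (by simp only [val_succAbove, firstCol, shiftCol]; exact h s s.2))
  rw [← h1]
  congr 1
  exact Fin.ext (by simp only [val_succAbove, firstCol]; exact hl.symm)

theorem b_01 (c : ℕ) : b c (firstCol c 0) (firstCol c 1) = (-1) ^ c * (z c 0 2 * w c) := by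
  rw [b_firstCol_of c (m := 2) c (2 * c) (by omega) (by omega)
    (by simp) (by simp; split_ifs <;> omega) (by intro s hs; simp; split_ifs <;> omega)]
  rw [pow_mul]
  simp

theorem b_02 (c : ℕ) : b c (firstCol c 0) (firstCol c 2) = -((-1) ^ c * (z c 0 1 * w c)) := by
  rw [b_firstCol_of c (m := 1) (2 * c + 1) c (by omega) (by omega)
    (by simp; omega) (by simp; omega) (by intro s hs; simp; split_ifs <;> omega)]
  rw [pow_succ, pow_mul]
  simp

theorem b_10 (c : ℕ) : b c (firstCol c 1) (firstCol c 0) = z c 0 2 * w c := by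
  rw [b_firstCol_of c (m := 2) 0 (2 * c) (by omega) (by omega)
    (by simp) (by simp; split_ifs <;> omega) (by intro s hs; simp; split_ifs <;> omega)]
  rw [pow_mul]
  simp

theorem b_12 (c : ℕ) : b c (firstCol c 1) (firstCol c 2) = -(z c 0 0 * w c) := by
  rw [b_firstCol_of c (m := 0) (2 * c + 1) 0 (by omega) (by omega)
    (by simp; split_ifs <;> omega) (by simp) (by intro s hs; simp; split_ifs <;> omega)]
  rw [pow_succ, pow_mul]
  simp

theorem b_20 (c : ℕ) : b c (firstCol c 2) (firstCol c 0) = (-1) ^ c * (z c 0 1 * w c) := by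
  rw [b_firstCol_of c (m := 1) 0 c (by omega) (by omega)
    (by simp) (by simp) (by intro s hs; simp; split_ifs <;> omega)]
  simp

theorem b_21 (c : ℕ) : b c (firstCol c 2) (firstCol c 1) = -((-1) ^ c * (z c 0 0 * w c)) := by
  rw [b_firstCol_of c (m := 0) (c + 1) 0 (by omega) (by omega)
    (by simp) (by simp) (by intro s hs; simp; split_ifs <;> omega)]
  rw [pow_succ]
  simp

/-- The entries of `d₃`, as elements of `ℤ[z]`. -/
def delta (c : ℕ) : Fin 3 → R c := ![z c 0 0, (-1) ^ (c + 1) * z c 0 1, z c 0 2]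

theorem sum_delta_smul_b (c : ℕ) :
    delta c 0 • b c (firstCol c 0) + delta c 1 • b c (firstCol c 1) +
      delta c 2 • b c (firstCol c 2) = 0 := by
  set u := delta c 0 • b c (firstCol c 0) + delta c 1 • b c (firstCol c 1) +
      delta c 2 • b c (firstCol c 2) with hu
  have hA : (A c).mulVec u = 0 := by
    simp only [hu, Matrix.mulVec_add, Matrix.mulVec_smul, A_mulVec_b, smul_zero, add_zero]
  have hfirst (l : Fin 3) : u (firstCol c l) = 0 := by
    have he : ((-1 : R c) ^ c) * (-1) ^ c = 1 := by rw [← mul_pow]; simp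
    fin_cases l <;> simp [hu, delta, b_firstCol_self, b_01, b_02, b_10, b_12, b_20, b_21]
    · ring
    · ring
    · ring
  -- As `u` vanishes at the first columns, the lower rows of `A u = 0` involve only the shifted
  -- columns, on which they form `M_c`.
  have hsq : (Asq c).mulVec (fun s => u (shiftCol c s)) = 0 := by
    funext r
    have h1 := congrFun hA r.succ
    simp only [Matrix.mulVec, dotProduct, Pi.zero_apply] at h1 ⊢
    rw [← h1]
    refine Finset.sum_of_injOn (shiftCol c) (shiftCol_injective c).injOn (by simp) ?_ ?_
    · intro s _ hs
      rcases exists_firstCol_or_shiftCol c s with ⟨j, rfl⟩ | ⟨t, rfl⟩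
      · rw [hfirst, mul_zero]
      · exact absurd ⟨t, by simp, rfl⟩ hs
    · intro s _
      rw [A_succ_shiftCol]
  have h0 := Matrix.eq_zero_of_mulVec_eq_zero (w_ne_zero c) hsq
  funext s
  rcases exists_firstCol_or_shiftCol c s with ⟨j, rfl⟩ | ⟨t, rfl⟩
  · exact hfirst j
  · exact congrFun h0 t

end Determinants

/-! ### Homogeneous components -/

section Homogeneous

open MvPolynomial

variable {σ K : Type*} [CommRing K]

theorem homogeneousComponent_add_mul {q : MvPolynomial σ K} {d : ℕ} (hq : q.IsHomogeneous d)
    (m : ℕ) (p : MvPolynomial σ K) :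
    homogeneousComponent (m + d) (p * q) = homogeneousComponent m p * q := by
  conv_lhs => rw [← sum_homogeneousComponent p, Finset.sum_mul, map_sum]
  have h (i : ℕ) : homogeneousComponent (m + d) (homogeneousComponent i p * q) =
      if m = i then homogeneousComponent i p * q else 0 := by
    rw [homogeneousComponent_of_mem ((homogeneousComponent_isHomogeneous i p).mul hq)]
    simp
  simp only [h, Finset.sum_ite_eq, Finset.mem_range]
  split_ifs with hm
  · rfl
  · rw [homogeneousComponent_eq_zero _ _ (by omega), zero_mul]

theorem isHomogeneous_iff_component {p : MvPolynomial σ K} {n : ℕ} :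
    p.IsHomogeneous n ↔ ∀ m, m ≠ n → homogeneousComponent m p = 0 := by
  refine ⟨fun h m hm => by rw [homogeneousComponent_of_mem h, if_neg hm], fun h => ?_⟩
  rw [← sum_homogeneousComponent p]
  refine IsHomogeneous.sum _ _ _ fun i _ => ?_
  by_cases hi : i = n
  · exact hi ▸ homogeneousComponent_isHomogeneous i p
  · rw [h i hi]
    exact isHomogeneous_zero _ _ _

theorem coprime_X_pow [IsDomain K] (n : ℕ) (s t : MvPolynomial (Fin 2) K)
    (h : (X 1 ^ n : MvPolynomial (Fin 2) K) * s = X 0 ^ n * t) : X 0 ^ n ∣ s := by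
  have hp : Prime (X 0 : MvPolynomial (Fin 2) K) := X_prime
  refine hp.pow_dvd_of_dvd_mul_left n ?_ ⟨t, h⟩
  intro hd
  have := hp.dvd_of_dvd_pow hd
  rw [X_dvd_X] at this
  simp at this

theorem eq_sum_of_isHomogeneous {p : MvPolynomial (Fin 2) K} {d : ℕ} (hp : p.IsHomogeneous d) :
    p = ∑ i : Fin (d + 1), C (coeff (Finsupp.single 0 (i : ℕ) + Finsupp.single 1 (d - i)) p) *
      (X 0 ^ (i : ℕ) * X 1 ^ (d - (i : ℕ))) := by
  ext m
  have hm (i : ℕ) : coeff m (X 0 ^ i * X 1 ^ (d - i) : MvPolynomial (Fin 2) K) =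
      if m 0 = i ∧ m 1 = d - i then 1 else 0 := by
    rw [X_pow_eq_monomial, X_pow_eq_monomial, monomial_mul, coeff_monomial, one_mul]
    congr 1
    simp only [eq_iff_iff, Finsupp.ext_iff, Fin.forall_fin_two]
    simp [eq_comm]
  simp only [coeff_sum, coeff_C_mul, hm]
  by_cases h : m 0 + m 1 = d
  · rw [Finset.sum_eq_single ⟨m 0, by omega⟩]
    · rw [if_pos ⟨rfl, by simp; omega⟩, mul_one]
      congr 1
      ext a
      fin_cases a <;> simp
      omega
    · intro i _ hi
      rw [if_neg, mul_zero]
      rintro ⟨h1, -⟩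
      exact hi (Fin.ext h1.symm)
    · simp
  · rw [Finset.sum_eq_zero]
    · apply hp.coeff_eq_zero
      rw [Finsupp.degree_eq_sum]
      simpa using h
    · intro i _
      rw [if_neg, mul_zero]
      have := i.2
      omega

end Homogeneous

/-! ### Multiplication by the generic forms -/

section Multiplication

open MvPolynomial

variable {c : ℕ} {K : Type*} [CommRing K] (η : R c →+* K)

theorem map_G (j : Fin 3) : map η (G c j) = ∑ i : Fin (2 * c + 1), C (η (z c i j)) *
    (X 0 ^ (i : ℕ) * X 1 ^ (2 * c - (i : ℕ))) := by
  simp [G]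

theorem isHomogeneous_map_G (j : Fin 3) : (map η (G c j)).IsHomogeneous (2 * c) := by
  rw [map_G]
  refine IsHomogeneous.sum _ _ _ fun i _ => ?_
  have h := (isHomogeneous_C (Fin 2) (η (z c i j))).mul
    ((isHomogeneous_X_pow (R := K) (0 : Fin 2) (i : ℕ)).mul
      (isHomogeneous_X_pow (R := K) (1 : Fin 2) (2 * c - i)))
  convert h using 1
  omega

/-- Column `o` of block `j` lists the coefficients of `x^o y^(n-1-o) G_j`. -/
theorem sum_entry {n m : ℕ} (hn : 0 < n) (hm : m = 2 * c + n) (s : ℕ) (hs : s / n < 3) :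
    ∑ r : Fin m, C (η (entry c n r s)) * (X 0 ^ (r : ℕ) * X 1 ^ (m - 1 - r)) =
      map η (G c ⟨s / n, hs⟩) *
        (X 0 ^ (s % n) * X 1 ^ (n - 1 - s % n) : MvPolynomial (Fin 2) K) := by
  have hlt := Nat.mod_lt s hn
  rw [map_G, Finset.sum_mul]
  symm
  refine Finset.sum_of_injOn (fun i : Fin (2 * c + 1) => ⟨i + s % n, by omega⟩) ?_ ?_ ?_ ?_
  · intro i _ j _ h
    simp only [Fin.mk.injEq] at h
    exact Fin.ext (by omega)
  · simp
  · intro r _ hr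
    rw [entry, dif_neg]
    · simp
    · rintro ⟨h1, h2, -⟩
      exact hr ⟨⟨r - s % n, h2⟩, by simp, Fin.ext (by simp; omega)⟩
  · intro i _
    have hi := i.2
    rw [entry_add c n s i hi hs]
    have e : m - 1 - (i + s % n) = (2 * c - i) + (n - 1 - s % n) := by omega
    simp only [e, pow_add]
    ring

/-- The vector of three binary forms of degree `n - 1` with coefficient vector `u`. -/
def polyVec (n : ℕ) {q : ℕ} (u : Fin q → K) : Fin 3 → MvPolynomial (Fin 2) K := fun l =>
  ∑ s : Fin q, if (s : ℕ) / n = l then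
    C (u s) * (X 0 ^ ((s : ℕ) % n) * X 1 ^ (n - 1 - (s : ℕ) % n)) else 0

theorem isHomogeneous_polyVec {n : ℕ} (hn : 0 < n) {q : ℕ} (u : Fin q → K) (l : Fin 3) :
    (polyVec n u l).IsHomogeneous (n - 1) := by
  refine IsHomogeneous.sum _ _ _ fun s _ => ?_
  split_ifs
  · have h := (isHomogeneous_C (Fin 2) (u s)).mul
      ((isHomogeneous_X_pow (R := K) (0 : Fin 2) ((s : ℕ) % n)).mul
        (isHomogeneous_X_pow (R := K) (1 : Fin 2) (n - 1 - (s : ℕ) % n)))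
    have := Nat.mod_lt s hn
    convert h using 1
    omega
  · exact isHomogeneous_zero _ _ _

theorem rowMap_polyVec {n m q : ℕ} (hn : 0 < n) (hm : m = 2 * c + n) (hq : q = 3 * n)
    (u : Fin q → K) : rowMap (fun j => map η (G c j)) (polyVec n u) =
      ∑ r : Fin m, C (∑ s : Fin q, η (entry c n r s) * u s) *
        (X 0 ^ (r : ℕ) * X 1 ^ (m - 1 - r)) := by
  simp only [map_sum, Finset.sum_mul]
  rw [Finset.sum_comm, rowMap, Fintype.linearCombination_apply]
  simp only [polyVec, Finset.sum_smul]
  rw [Finset.sum_comm]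
  refine Finset.sum_congr rfl fun s _ => ?_
  have hs : (s : ℕ) / n < 3 := Nat.div_lt_of_lt_mul (by have := s.2; rw [mul_comm]; omega)
  have h1 := sum_entry η hn hm s hs
  rw [Finset.sum_eq_single ⟨(s : ℕ) / n, hs⟩]
  · rw [if_pos rfl, smul_eq_mul, mul_assoc, mul_comm _ (map η _), ← h1, Finset.mul_sum]
    refine Finset.sum_congr rfl fun r _ => ?_
    rw [C_mul]
    ring
  · intro l _ hl
    rw [if_neg, zero_smul]
    intro h
    exact hl (Fin.ext h.symm)
  · simp

theorem polyVec_injective {n : ℕ} {q : ℕ} {u : Fin q → K} (hq : q = 3 * n)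
    (h : polyVec n u = 0) : u = 0 := by
  funext s
  have hs : (s : ℕ) / n < 3 := Nat.div_lt_of_lt_mul (by have := s.2; rw [mul_comm]; omega)
  have h1 := congrArg (coeff (Finsupp.single 0 ((s : ℕ) % n) +
    Finsupp.single 1 (n - 1 - (s : ℕ) % n))) (congrFun h ⟨(s : ℕ) / n, hs⟩)
  simp only [polyVec, Pi.zero_apply, coeff_zero, coeff_sum] at h1
  rw [Finset.sum_eq_single s] at h1
  · rw [if_pos rfl, X_pow_eq_monomial, X_pow_eq_monomial, monomial_mul, coeff_C_mul,
      coeff_monomial, if_pos rfl] at h1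
    simpa using h1
  · intro t _ ht
    split_ifs with h2
    · rw [X_pow_eq_monomial, X_pow_eq_monomial, monomial_mul, coeff_C_mul,
        coeff_monomial, if_neg]
      · simp
      · intro h3
        have h4 := DFunLike.congr_fun h3 0
        simp at h4
        apply ht
        have e1 := Nat.div_add_mod (t : ℕ) n
        have e2 := Nat.div_add_mod (s : ℕ) n
        rw [h2, h4, e2] at e1
        exact Fin.ext e1.symm
    · simp
  · simp

/-- At `x = 0`, `y = 1` only the pure power `y^c` survives, and its coefficient sits in the first
column of the block. -/
theorem eval_polyVec {u : Fin (3 * c + 3) → K} (l : Fin 3) :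
    eval ![0, 1] (polyVec (c + 1) u l) = u (firstCol c l) := by
  simp only [polyVec, map_sum]
  rw [Finset.sum_eq_single (firstCol c l)]
  · simp [firstCol]
  · intro s _ hs
    split_ifs with h
    · have : (s : ℕ) % (c + 1) ≠ 0 := by
        intro h0
        apply hs
        have := Nat.div_add_mod (s : ℕ) (c + 1)
        exact Fin.ext (by simp only [firstCol]; rw [← this, h0, h, add_zero, mul_comm])
      simp [this]
    · simp
  · simp

theorem eval_G (j : Fin 3) : eval ![0, 1] (G c j) = z c 0 j := by
  simp only [G, map_sum]
  rw [Finset.sum_eq_single 0]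
  · simp
  · intro i _ hi
    have : (i : ℕ) ≠ 0 := fun h => hi (Fin.ext h)
    simp [this]
  · simp

end Multiplication

/-! ### The matrices `d₂` and `d₃` -/

section Differentials

open MvPolynomial

variable {c : ℕ}

theorem N_mulVec (u : Fin (3 * c + 3) → R c) :
    (N c).mulVec (fun s => C (u s)) = polyVec (c + 1) u := by
  funext l
  simp only [Matrix.mulVec, dotProduct, N, Matrix.of_apply, polyVec, Nat.add_sub_cancel]
  refine Finset.sum_congr rfl fun s _ => ?_
  split_ifs
  · ring
  · simp

theorem d2_apply (i j : Fin 3) : d2 c i j = polyVec (c + 1) (b c (firstCol c j)) i := by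
  rw [← N_mulVec]
  rfl

theorem map_id_G : (fun j => map (RingHom.id (R c)) (G c j)) = G c := by
  funext j
  exact MvPolynomial.map_id _

theorem rowMap_d2_col (j : Fin 3) : rowMap (G c) (fun i => d2 c i j) = 0 := by
  simp only [d2_apply]
  rw [← map_id_G, rowMap_polyVec (RingHom.id (R c)) (n := c + 1) (m := 3 * c + 1) (by omega)
    (by omega) (by omega)]
  refine Finset.sum_eq_zero fun r _ => ?_
  have := congrFun (A_mulVec_b c (firstCol c j)) r
  simp only [Matrix.mulVec, dotProduct, A, Matrix.of_apply, Pi.zero_apply] at this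
  simp [this]

theorem d3_eq (j : Fin 3) : d3 c j = C (delta c j) := by
  fin_cases j <;> simp [d3, delta]

theorem d2_mulVec_d3 : (d2 c).mulVec (d3 c) = 0 := by
  have h := N_mulVec (delta c 0 • b c (firstCol c 0) + delta c 1 • b c (firstCol c 1) +
      delta c 2 • b c (firstCol c 2))
  rw [sum_delta_smul_b] at h
  have h0 : polyVec (c + 1) (0 : Fin (3 * c + 3) → R c) = 0 := by
    funext l
    simp [polyVec]
  rw [h0] at h
  have hd : d2 c = N c * (Matrix.of fun s j => C (b c (firstCol c j) s) :
      Matrix (Fin (3 * c + 3)) (Fin 3) (S c)) := rfl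
  rw [hd, ← Matrix.mulVec_mulVec, ← h]
  congr 1
  funext s
  have hs := congrFun (sum_delta_smul_b c) s
  simp only [Pi.add_apply, Pi.smul_apply, smul_eq_mul, Pi.zero_apply] at hs ⊢
  rw [← hs]
  simp [Matrix.mulVec, dotProduct, Fin.sum_univ_three, d3_eq]
  ring

theorem isHomogeneous_d2 (i j : Fin 3) : (d2 c i j).IsHomogeneous c := by
  rw [d2_apply]
  exact isHomogeneous_polyVec (Nat.succ_pos c) _ i

/-- Column `r` of the adjugate of `M_c`, read as a triple of forms of degree `c - 1`, is mapped to
`w` times the `r`-th monomial of degree `3c - 1`. -/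
theorem exists_rowMap_eq (r : Fin (3 * c)) (hc : 0 < c) :
    ∃ u, rowMap (G c) u = C (w c) * (X 0 ^ (r : ℕ) * X 1 ^ (3 * c - 1 - r)) := by
  refine ⟨polyVec c fun s => (Asq c).adjugate s r, ?_⟩
  rw [← map_id_G, rowMap_polyVec (RingHom.id (R c)) (m := 3 * c) hc (by omega) rfl]
  have h (r' : Fin (3 * c)) : ∑ s : Fin (3 * c), RingHom.id (R c) (entry c c r' s) *
      (Asq c).adjugate s r = if r' = r then w c else 0 := by
    have := congrFun₂ (Matrix.mul_adjugate (Asq c)) r' r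
    simpa [Matrix.mul_apply, Matrix.one_apply, Asq, w] using this
  simp only [h]
  rw [Finset.sum_eq_single r]
  · simp
  · intro r' _ hr
    simp [hr]
  · simp

end Differentials

/-! ### The minors of `d₂` -/

section Minors

theorem Phi_map {T U : Type*} [CommRing T] [CommRing U] (f : T →+* U)
    (Q : Matrix (Fin 3) (Fin 2) T) : Phi (Q.map f) = fun i => f (Phi Q i) := by
  rw [Phi_eq, Phi_eq]
  funext i
  fin_cases i <;> simp

theorem rowMap_map {T U : Type*} [CommRing T] [CommRing U] (f : T →+* U) (G v : Fin 3 → T) :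
    rowMap (fun j => f (G j)) (fun j => f (v j)) = f (rowMap G v) := by
  simp [rowMap_apply]

/-- If `G` annihilates the columns of `Q` and generates an ideal of large grade, then the vector of
minors of `Q` is proportional to `G`. -/
theorem exists_mul_Phi_eq {T : Type*} [CommRing T] [IsDomain T] {Q : Matrix (Fin 3) (Fin 2) T}
    {G : Fin 3 → T} {w a b : T} (hw : w ≠ 0) (ha : a ≠ 0) (haG : ∃ u, rowMap G u = w * a)
    (hbG : ∃ u, rowMap G u = w * b) (hab : ∀ s t, b * s = a * t → a ∣ s)
    (hQ : ∀ l, rowMap G (fun i => Q i l) = 0) : ∃ q, ∀ i, w * Phi Q i = q * G i := by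
  -- This is `(q₀ × q₁) × G = 0`, since `G` is orthogonal to both columns of `Q`.
  have hc (i j : Fin 3) : Phi Q i * G j = Phi Q j * G i := by
    have h0 := hQ 0
    have h1 := hQ 1
    rw [rowMap_apply] at h0 h1
    rw [Phi_eq]
    fin_cases i <;> fin_cases j <;> simp
    · linear_combination Q 2 1 * h0 - Q 2 0 * h1
    · linear_combination -Q 1 1 * h0 + Q 1 0 * h1
    · linear_combination -Q 2 1 * h0 + Q 2 0 * h1
    · linear_combination Q 0 1 * h0 - Q 0 0 * h1
    · linear_combination Q 1 1 * h0 - Q 1 0 * h1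
    · linear_combination -Q 0 1 * h0 + Q 0 0 * h1
  obtain ⟨u, hu⟩ := haG
  obtain ⟨v, hv⟩ := hbG
  rw [rowMap_apply] at hu hv
  have hu' (i : Fin 3) : w * a * Phi Q i =
      (u 0 * Phi Q 0 + u 1 * Phi Q 1 + u 2 * Phi Q 2) * G i := by
    rw [← hu]
    linear_combination u 0 * hc i 0 + u 1 * hc i 1 + u 2 * hc i 2
  have hv' (i : Fin 3) : w * b * Phi Q i =
      (v 0 * Phi Q 0 + v 1 * Phi Q 1 + v 2 * Phi Q 2) * G i := by
    rw [← hv]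
    linear_combination v 0 * hc i 0 + v 1 * hc i 1 + v 2 * hc i 2
  set α := u 0 * Phi Q 0 + u 1 * Phi Q 1 + u 2 * Phi Q 2
  set β := v 0 * Phi Q 0 + v 1 * Phi Q 1 + v 2 * Phi Q 2
  -- Now `w a Φ = α G` and `w b Φ = β G`. The factor `w` is kept apart from `a`, `b` because only
  -- the latter are coprime; `a ∣ α` then yields `w Φ = q G`.
  have hβ : b * α = a * β := by
    apply mul_left_cancel₀ (mul_ne_zero hw ha)
    rw [← hu]
    linear_combination (-b * u 0) * hu' 0 + (-b * u 1) * hu' 1 + (-b * u 2) * hu' 2 +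
      (a * u 0) * hv' 0 + (a * u 1) * hv' 1 + (a * u 2) * hv' 2
  obtain ⟨q, hq⟩ := hab _ _ hβ
  refine ⟨q, fun i => mul_left_cancel₀ ha ?_⟩
  linear_combination hu' i + G i * hq

open MvPolynomial

variable {c : ℕ}

theorem exists_rowMap_X_zero (hc : 0 < c) :
    ∃ u, rowMap (G c) u = C (w c) * X 0 ^ (3 * c - 1) := by
  simpa using exists_rowMap_eq (c := c) ⟨3 * c - 1, by omega⟩ hc

theorem exists_rowMap_X_one (hc : 0 < c) :
    ∃ u, rowMap (G c) u = C (w c) * X 1 ^ (3 * c - 1) := by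
  simpa using exists_rowMap_eq (c := c) ⟨0, by omega⟩ hc

theorem isHomogeneous_Phi_d2del (j i : Fin 3) : (Phi (d2del c j) i).IsHomogeneous (2 * c) := by
  have h (i i' l l' : Fin 3) : (d2 c i l * d2 c i' l').IsHomogeneous (2 * c) := by
    have h1 := (isHomogeneous_d2 (c := c) i l).mul (isHomogeneous_d2 (c := c) i' l')
    rwa [show c + c = 2 * c by omega] at h1
  rw [Phi_eq]
  fin_cases i <;> simp only [d2del, Matrix.submatrix_apply, id]
  · exact (h _ _ _ _).sub (h _ _ _ _)
  · exact ((h _ _ _ _).sub (h _ _ _ _)).neg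
  · exact (h _ _ _ _).sub (h _ _ _ _)

theorem z_zero_ne_zero (j : Fin 3) : z c 0 j ≠ 0 := MvPolynomial.X_ne_zero _

theorem eval_d2 (i j : Fin 3) : eval ![0, 1] (d2 c i j) = b c (firstCol c j) (firstCol c i) := by
  rw [d2_apply, eval_polyVec]

theorem eval_Phi_d2del_zero (j : Fin 3) : eval ![0, 1] (Phi (d2del c j) 0) =
    -((-1) ^ (((j : ℕ) + 1) * c) * (z c 0 j * w c ^ 2)) * z c 0 0 := by
  have he : ((-1 : R c) ^ c) * (-1) ^ c = 1 := by rw [← mul_pow]; simp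
  rw [Phi_eq]
  fin_cases j <;>
    simp [d2del, eval_d2, b_firstCol_self, b_01, b_02, b_12, b_21, Fin.succAbove, Fin.lt_def, pow_mul]
  · ring
  · linear_combination (z c 0 0 * z c 0 1 * w c ^ 2) * he
  · ring

theorem Phi_d2del (hc : 0 < c) (j : Fin 3) : Phi (d2del c j) =
    (-C ((-1) ^ (((j : ℕ) + 1) * c) * (z c 0 j * w c ^ 2)) : S c) • G c := by
  obtain ⟨q, hq⟩ := exists_mul_Phi_eq (Q := d2del c j) (w := C (w c)) (a := X 0 ^ (3 * c - 1))
    (by simpa using w_ne_zero c) (pow_ne_zero _ (MvPolynomial.X_ne_zero _))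
    (exists_rowMap_X_zero hc) (exists_rowMap_X_one hc) (coprime_X_pow _)
    (fun l => rowMap_d2_col _)
  have hG (i : Fin 3) : (G c i).IsHomogeneous (2 * c) := by
    rw [← congrFun map_id_G i]
    exact isHomogeneous_map_G _ i
  -- Both sides have degree `2c` up to the factor `q`, so comparing components of that degree
  -- replaces `q` by its constant term.
  have hq' (i : Fin 3) : C (w c) * Phi (d2del c j) i = C (coeff 0 q) * G c i := by
    have h := congrArg (homogeneousComponent (0 + 2 * c)) (hq i)
    rwa [homogeneousComponent_add_mul (hG i), homogeneousComponent_zero,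
      homogeneousComponent_C_mul, zero_add,
      homogeneousComponent_eq_self (isHomogeneous_Phi_d2del j i)] at h
  have hq0 := congrArg (eval ![0, 1]) (hq' 0)
  rw [map_mul, map_mul, eval_C, eval_C, eval_Phi_d2del_zero, eval_G] at hq0
  have hq1 : coeff 0 q = w c * -((-1) ^ (((j : ℕ) + 1) * c) * (z c 0 j * w c ^ 2)) := by
    apply mul_right_cancel₀ (z_zero_ne_zero (c := c) 0)
    rw [← hq0]
    ring
  funext i
  apply mul_left_cancel₀ (a := (C (w c) : S c)) (by simpa using w_ne_zero c)
  rw [hq', hq1]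
  simp only [Pi.smul_apply, smul_eq_mul, C_mul, C_neg]
  ring

end Minors

/-! ### Specialization of the generic complexes -/

section Specialization

open MvPolynomial

variable {c : ℕ} {K : Type*} [CommRing K] (η : R c →+* K)

theorem exists_rowMap_map_X_zero (hc : 0 < c) (hw : IsUnit (η (w c))) :
    ∃ u, rowMap (fun j => map η (G c j)) u = X 0 ^ (3 * c - 1) := by
  obtain ⟨u, hu⟩ := exists_rowMap_X_zero hc
  obtain ⟨q, hq⟩ := hw
  refine ⟨(C (↑q⁻¹ : K) : MvPolynomial (Fin 2) K) • fun j => map η (u j), ?_⟩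
  rw [map_smul, rowMap_map, hu, map_mul, map_C, ← hq, smul_eq_mul, ← mul_assoc, ← C_mul]
  simp

theorem exists_rowMap_map_X_one (hc : 0 < c) (hw : IsUnit (η (w c))) :
    ∃ u, rowMap (fun j => map η (G c j)) u = X 1 ^ (3 * c - 1) := by
  obtain ⟨u, hu⟩ := exists_rowMap_X_one hc
  obtain ⟨q, hq⟩ := hw
  refine ⟨(C (↑q⁻¹ : K) : MvPolynomial (Fin 2) K) • fun j => map η (u j), ?_⟩
  rw [map_smul, rowMap_map, hu, map_mul, map_C, ← hq, smul_eq_mul, ← mul_assoc, ← C_mul]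
  simp

theorem Phi_map_d2del (hc : 0 < c) (j : Fin 3) : Phi ((d2del c j).map (map η)) =
    (-C (η ((-1) ^ (((j : ℕ) + 1) * c) * (z c 0 j * w c ^ 2))) : MvPolynomial (Fin 2) K) •
      fun i => map η (G c i) := by
  rw [Phi_map, Phi_d2del hc]
  funext i
  simp only [Pi.smul_apply, smul_eq_mul, map_mul (map η), map_neg (map η), map_C]

theorem rowMap_map_d2 (v : Fin 3 → MvPolynomial (Fin 2) K) :
    rowMap (fun i => map η (G c i)) (((d2 c).map (map η)).mulVec v) = 0 := by
  have h (j : Fin 3) : rowMap (fun i => map η (G c i)) (fun i => map η (d2 c i j)) = 0 := by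
    rw [rowMap_map, rowMap_d2_col, map_zero]
  have h0 := h 0
  have h1 := h 1
  have h2 := h 2
  simp only [rowMap_apply, Matrix.mulVec, dotProduct, Fin.sum_univ_three, Matrix.map_apply] at *
  linear_combination v 0 * h0 + v 1 * h1 + v 2 * h2

theorem rowMap_map_d2del (j : Fin 3) (e : Fin 2 → MvPolynomial (Fin 2) K) :
    rowMap (fun i => map η (G c i)) (((d2del c j).map (map η)).mulVec e) = 0 := by
  have h := mulVec_submatrix_succAbove ((d2 c).map (map η))
    (j.insertNth (α := fun _ => MvPolynomial (Fin 2) K) 0 e) j (by simp)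
  simp only [Fin.insertNth_apply_succAbove] at h
  have h' := rowMap_map_d2 η (j.insertNth (α := fun _ => MvPolynomial (Fin 2) K) 0 e)
  rw [← h] at h'
  exact h'

/-- The coefficients of the splitting `σ`, up to the factor `1 / w`. -/
def signedZ (c : ℕ) : Fin 3 → R c := ![Z c 0, (-1) ^ (c + 1) * Z c 1, Z c 2]

/-- The units `r j` absorb `w²` and all signs, including the sign `(-1)^(j(c+1))` relating the entry
of `d₃` to `z_{0,j}`. The splitting is the first-row expansion of `w`, in which the signs of `d₃`
and `σ` cancel. -/
theorem exactData [IsDomain K] (hc : 0 < c) {winv : K} (hw : winv * η (w c) = 1) :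
    ExactData ((d2 c).map (map η)) (fun j => map η (G c j)) (fun j => map η (d3 c j))
      (fun j => C (winv * η (signedZ c j)))
      (fun j => -C (η ((-1) ^ (((j : ℕ) + 1) * c) * ((-1) ^ ((j : ℕ) * (c + 1)) * w c ^ 2))))
      (X 0 ^ (3 * c - 1)) (X 1 ^ (3 * c - 1)) := by
  have hu : IsUnit (η (w c)) := IsUnit.of_mul_eq_one_right _ hw
  have hs (m : ℕ) : ((-1 : R c) ^ m) * (-1) ^ m = 1 := by rw [← mul_pow]; simp
  refine ⟨fun j => ?_, fun j => ?_, rowMap_map_d2 η, ?_, ?_, pow_ne_zero _ (X_ne_zero _),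
    exists_rowMap_map_X_zero η hc hu, exists_rowMap_map_X_one η hc hu, coprime_X_pow _⟩
  · have h1 : ((d2 c).map (map η)).submatrix id j.succAbove = (d2del c j).map (map η) := rfl
    rw [h1, Phi_map_d2del η hc]
    congr 1
    rw [d3_eq, map_C, neg_mul, ← C_mul, ← map_mul]
    congr 3
    have hd : delta c j = (-1) ^ ((j : ℕ) * (c + 1)) * z c 0 j := by
      fin_cases j <;> simp [delta]
    rw [hd]
    linear_combination (-(-1) ^ (((j : ℕ) + 1) * c) * (z c 0 j * w c ^ 2)) *
      hs ((j : ℕ) * (c + 1))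
  · refine (IsUnit.map C ?_).neg
    simp only [map_mul, map_pow, map_neg, map_one]
    exact ((isUnit_one.neg.pow _).mul ((isUnit_one.neg.pow _).mul (hu.pow 2)))
  · funext i
    have h := congrArg (map η) (congrFun d2_mulVec_d3 i)
    simpa [Matrix.mulVec, dotProduct, Fin.sum_univ_three] using h
  · rw [rowMap_apply]
    simp only [d3_eq, map_C, ← C_mul, ← C_add]
    rw [← C_1]
    congr 1
    rw [← hw, w_eq_sum c hc, Fin.sum_univ_three]
    have h : delta c 0 * signedZ c 0 + delta c 1 * signedZ c 1 + delta c 2 * signedZ c 2 =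
        z c 0 0 * Z c 0 + z c 0 1 * Z c 1 + z c 0 2 * Z c 2 := by
      simp [delta, signedZ]
      linear_combination (z c 0 1 * Z c 1) * hs (c + 1)
    rw [← h]
    simp only [map_add, map_mul]
    ring

end Specialization

/-! ### Localization -/

section Localization

open MvPolynomial

variable {c : ℕ}

theorem isDomain_away {f : R c} (hf : f ≠ 0) : IsDomain (Localization.Away f) :=
  IsLocalization.isDomain_localization
    (powers_le_nonZeroDivisors_of_noZeroDivisors hf)

theorem exactData_w (hc : 0 < c) :
    ExactData ((d2 c).map (toLoc (w c))) (fun j => toLoc (w c) (G c j))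
      (fun j => toLoc (w c) (d3 c j))
      (fun j => C (IsLocalization.Away.invSelf (w c) *
        algebraMap (R c) (Localization.Away (w c)) (signedZ c j)))
      (fun j => -C (algebraMap (R c) (Localization.Away (w c))
        ((-1) ^ (((j : ℕ) + 1) * c) * ((-1) ^ ((j : ℕ) * (c + 1)) * w c ^ 2))))
      (X 0 ^ (3 * c - 1)) (X 1 ^ (3 * c - 1)) := by
  have := isDomain_away (w_ne_zero c)
  refine exactData _ hc ?_
  exact (mul_comm _ _).trans (IsLocalization.Away.mul_invSelf (w c))

theorem isResolutionOfLengthTwo_d2delLoc (hc : 0 < c) (j : Fin 3) :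
    IsResolutionOfLengthTwo (d2delLoc (w c * z c 0 j) j) (d1Loc (w c * z c 0 j))
      (genericIdeal (w c * z c 0 j)) := by
  have := isDomain_away (mul_ne_zero (w_ne_zero c) (z_zero_ne_zero j))
  have hu := IsLocalization.Away.algebraMap_isUnit (S := Localization.Away (w c * z c 0 j))
    (w c * z c 0 j)
  rw [map_mul] at hu
  have hw := isUnit_of_mul_isUnit_left hu
  have hz := isUnit_of_mul_isUnit_right hu
  refine isResolutionOfLengthTwo_of_Phi (Phi_map_d2del _ hc j) ?_ (pow_ne_zero _ (X_ne_zero _))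
    (exists_rowMap_map_X_zero _ hc hw) (exists_rowMap_map_X_one _ hc hw) (coprime_X_pow _)
    (rowMap_map_d2del _ j)
  refine (IsUnit.map C ?_).neg
  simp only [map_mul, map_pow, map_neg, map_one]
  exact (isUnit_one.neg.pow _).mul (hz.mul (hw.pow 2))

theorem projective_UPR₂ (hc : 0 < c) : Module.Projective (Loc (w c)) (UPR₂ c) :=
  (exactData_w hc).projective_ker

theorem isResolutionOfLengthTwo_uprMap₂ (hc : 0 < c) :
    IsResolutionOfLengthTwo (uprMap₂ c) (d1Loc (w c)) (genericIdeal (w c)) :=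
  have := isDomain_away (w_ne_zero c)
  (exactData_w hc).isResolutionOfLengthTwo_ker

/-- The kernel is `(x, y)`, a prime with two generators, so Krull's height theorem applies. -/
theorem height_ker_constantCoeff_le {K : Type*} [CommRing K] [IsDomain K] [IsNoetherianRing K] :
    (RingHom.ker (constantCoeff (σ := Fin 2) (R := K))).height ≤ 2 := by
  have hprime : (RingHom.ker (constantCoeff (σ := Fin 2) (R := K))).IsPrime :=
    RingHom.ker_isPrime _
  have h : RingHom.ker (constantCoeff (σ := Fin 2) (R := K)) = Ideal.span (X '' Set.univ) := by
    ext p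
    rw [mem_ideal_span_X_image, RingHom.mem_ker, constantCoeff_eq]
    constructor
    · intro hp m hm
      by_contra! h0
      have : m = 0 := Finsupp.ext fun i => h0 i trivial
      rw [this, mem_support_iff] at hm
      exact hm hp
    · intro hp
      by_contra h0
      obtain ⟨i, -, hi⟩ := hp 0 (mem_support_iff.mpr h0)
      exact hi rfl
  refine (Ideal.height_le_spanFinrank _ hprime.ne_top).trans ?_
  rw [h]
  refine (Submodule.spanFinrank_span_le_encard _).trans ((Set.encard_image_le _ _).trans ?_)
  simp

theorem isPerfectOfGrade_genericIdeal (hc : 0 < c) :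
    IsPerfectOfGrade (genericIdeal (w c)) 2 := by
  have := isDomain_away (w_ne_zero c)
  have := projective_UPR₂ hc
  have hu := IsLocalization.Away.algebraMap_isUnit (S := Localization.Away (w c)) (w c)
  have hprime : (RingHom.ker (constantCoeff (σ := Fin 2)
    (R := Localization.Away (w c)))).IsPrime := RingHom.ker_isPrime _
  have : IsNoetherianRing (Localization.Away (w c)) :=
    IsLocalization.isNoetherianRing (Submonoid.powers (w c)) _ inferInstance
  refine isPerfectOfGrade_two (P := UPR₂ c) (G := fun j => toLoc (w c) (G c j))
    (f := uprMap₂ c) (isResolutionOfLengthTwo_uprMap₂ hc) (pow_ne_zero _ (X_ne_zero _))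
    (exists_rowMap_map_X_zero _ hc hu) (exists_rowMap_map_X_one _ hc hu) (coprime_X_pow _)
    height_ker_constantCoeff_le fun j => ?_
  rw [RingHom.mem_ker, constantCoeff_eq]
  refine (isHomogeneous_map_G _ j).coeff_eq_zero ?_
  simp
  omega

end Localization

/-! ### Homogeneous injective matrices -/

section HomogeneousMatrix

open MvPolynomial

variable {c : ℕ} {k : Type*} [CommRing k] {φ : Matrix (Fin 3) (Fin 2) (MvPolynomial (Fin 2) k)}

theorem homogeneousComponent_mulVec (hφ : ∀ i j, (φ i j).IsHomogeneous c) (m : ℕ)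
    (a : Fin 2 → MvPolynomial (Fin 2) k) (i : Fin 3) :
    homogeneousComponent (m + c) (φ.mulVec a i) =
      φ.mulVec (fun l => homogeneousComponent m (a l)) i := by
  simp only [Matrix.mulVec, dotProduct, map_sum]
  refine Finset.sum_congr rfl fun l _ => ?_
  rw [mul_comm, homogeneousComponent_add_mul (hφ i l), mul_comm]

/-- The map `φ` shifts degrees by `c`, so a component of `a` in a wrong degree is mapped to a
vanishing component of `φ a`; injectivity kills it. -/
theorem homogeneousComponent_eq_zero_of_mulVec (hφ : ∀ i j, (φ i j).IsHomogeneous c)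
    (hinj : Function.Injective φ.mulVecLin) {a : Fin 2 → MvPolynomial (Fin 2) k} {n m : ℕ}
    (ha : ∀ i, (φ.mulVec a i).IsHomogeneous n) (hm : m + c ≠ n) (l : Fin 2) :
    homogeneousComponent m (a l) = 0 := by
  have h : (fun l => homogeneousComponent m (a l)) = 0 := by
    apply hinj
    rw [map_zero]
    funext i
    rw [Matrix.mulVecLin_apply, ← homogeneousComponent_mulVec hφ,
      isHomogeneous_iff_component.mp (ha i) _ hm]
    rfl
  exact congrFun h l

theorem isHomogeneous_of_mulVec (hφ : ∀ i j, (φ i j).IsHomogeneous c)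
    (hinj : Function.Injective φ.mulVecLin) {a : Fin 2 → MvPolynomial (Fin 2) k} {n : ℕ}
    (ha : ∀ i, (φ.mulVec a i).IsHomogeneous (n + c)) (l : Fin 2) : (a l).IsHomogeneous n :=
  isHomogeneous_iff_component.mpr fun _ hm =>
    homogeneousComponent_eq_zero_of_mulVec hφ hinj ha (by omega) l

theorem eq_zero_of_mulVec_of_lt (hφ : ∀ i j, (φ i j).IsHomogeneous c)
    (hinj : Function.Injective φ.mulVecLin) {a : Fin 2 → MvPolynomial (Fin 2) k} {n : ℕ}
    (hn : n < c) (ha : ∀ i, (φ.mulVec a i).IsHomogeneous n) : a = 0 := by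
  funext l
  rw [← sum_homogeneousComponent (a l)]
  exact Finset.sum_eq_zero fun m _ =>
    homogeneousComponent_eq_zero_of_mulVec hφ hinj ha (by omega) l

theorem sum_range_homogeneousComponent {σ : Type*} {p : MvPolynomial σ k} {N : ℕ}
    (hN : p.totalDegree < N) : ∑ i ∈ Finset.range N, homogeneousComponent i p = p := by
  conv_rhs => rw [← sum_homogeneousComponent p]
  symm
  refine Finset.sum_subset (by simpa using hN) fun i _ hi => ?_
  rw [homogeneousComponent_eq_zero]
  simpa [Nat.lt_succ_iff] using hi

end HomogeneousMatrix

/-! ### The specialization attached to a resolution over a field -/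

section Universal

open MvPolynomial

variable {c : ℕ} {k : Type*} [Field k]

/-- The homomorphism `ℤ[z] → k` which sends `z_{i,j}` to the coefficient of `x ^ i y ^ (2c - i)`
in `g j`. -/
def coeffHom (c : ℕ) (g : Fin 3 → MvPolynomial (Fin 2) k) : R c →+* k :=
  eval₂Hom (Int.castRingHom k) fun p =>
    coeff (Finsupp.single 0 (p.1 : ℕ) + Finsupp.single 1 (2 * c - p.1)) (g p.2)

theorem map_coeffHom_G {g : Fin 3 → MvPolynomial (Fin 2) k}
    (hg : ∀ i, (g i).IsHomogeneous (2 * c)) (j : Fin 3) : map (coeffHom c g) (G c j) = g j := by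
  conv_rhs => rw [eq_sum_of_isHomogeneous (hg j)]
  rw [map_G]
  refine Finset.sum_congr rfl fun i _ => ?_
  simp [coeffHom, z]

theorem coeffHom_w_ne_zero (hc : 0 < c) {I : Ideal (MvPolynomial (Fin 2) k)}
    {g : Fin 3 → MvPolynomial (Fin 2) k} {φ : Matrix (Fin 3) (Fin 2) (MvPolynomial (Fin 2) k)}
    (h : IsBalancedResolution c I g φ) : coeffHom c g (w c) ≠ 0 := by
  intro h0
  rw [w, RingHom.map_det, ← Matrix.exists_mulVec_eq_zero_iff] at h0
  obtain ⟨u, hu, h0⟩ := h0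
  have h1 := rowMap_polyVec (coeffHom c g) (n := c) (m := 3 * c) hc (by omega) rfl u
  rw [funext (map_coeffHom_G h.homogeneous_g), Finset.sum_eq_zero] at h1
  · obtain ⟨a, ha⟩ := (h.resolution.2.1 _).mp h1
    -- A kernel vector of the specialized `M_c` is a syzygy of degree `c - 1`, below the degree `c`
    -- of the entries of `φ`.
    have ha0 : a = 0 := eq_zero_of_mulVec_of_lt h.homogeneous_φ h.resolution.1 (n := c - 1)
      (by omega) fun i => by
        rw [← Matrix.mulVecLin_apply, ha]
        exact isHomogeneous_polyVec hc u i
    rw [ha0, map_zero] at ha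
    exact hu (polyVec_injective rfl ha.symm)
  · intro r _
    have h2 := congrFun h0 r
    simp only [Matrix.mulVec, dotProduct, RingHom.mapMatrix_apply, Matrix.map_apply, Asq,
      Matrix.of_apply, Pi.zero_apply] at h2
    rw [h2, C_0, zero_mul]

/-- The homogeneous component of degree `n` of an element of `ker σ`. -/
def componentUPR₂ (n : ℕ) (v : UPR₂ c) : UPR₂ c :=
  ⟨fun l => homogeneousComponent n ((v : Fin 3 → Loc (w c)) l), by
    have hv := congrArg (homogeneousComponent n) (LinearMap.mem_ker.mp v.2)
    rw [LinearMap.mem_ker]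
    rw [map_zero] at hv
    rw [← hv]
    simp only [sigma, rowMap_apply, map_add, mul_comm _ (C _), homogeneousComponent_C_mul]⟩

theorem exists_sum_componentUPR₂ (v : UPR₂ c) :
    ∃ N, ∑ n ∈ Finset.range N, componentUPR₂ n v = v := by
  refine ⟨(∑ l : Fin 3, ((v : Fin 3 → Loc (w c)) l).totalDegree) + 1, ?_⟩
  ext1
  funext l
  rw [AddSubmonoidClass.coe_finsetSum, Finset.sum_apply]
  refine sum_range_homogeneousComponent (Nat.lt_succ_of_le ?_)
  exact Finset.single_le_sum (f := fun l => ((v : Fin 3 → Loc (w c)) l).totalDegree)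
    (fun _ _ => Nat.zero_le _) (Finset.mem_univ l)

theorem map_toLoc {α : Localization.Away (w c) →+* k} {η : R c →+* k}
    (hη : α.comp (algebraMap (R c) _) = η) (q : S c) :
    map α (toLoc (w c) q) = map η q := by
  rw [toLoc, map_map, hη]

section BaseChange

variable (α : Localization.Away (w c) →+* k) [Algebra (Loc (w c)) (MvPolynomial (Fin 2) k)]

/-- The differential of the base change of `UPR` from position `2` to position `1`. -/
def baseChangeMap₂ : (MvPolynomial (Fin 2) k ⊗[Loc (w c)] UPR₂ c) →ₗ[MvPolynomial (Fin 2) k]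
      (Fin 3 → MvPolynomial (Fin 2) k) :=
  (TensorProduct.piScalarRight (Loc (w c)) (MvPolynomial (Fin 2) k)
      (MvPolynomial (Fin 2) k) (Fin 3)).toLinearMap ∘ₗ
    (uprMap₂ c).baseChange (MvPolynomial (Fin 2) k)

/-- The degree `n` part of the base change of `UPR₂`, in the normalization where a tensor `p ⊗ v`
has the sum of the degrees of `p` and of the coordinates of `v`. -/
def gradedPart (n : ℕ) : AddSubgroup (MvPolynomial (Fin 2) k ⊗[Loc (w c)] UPR₂ c) :=
  AddSubgroup.closure {u : MvPolynomial (Fin 2) k ⊗[Loc (w c)] UPR₂ c |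
    ∃ (i j : ℕ) (p : MvPolynomial (Fin 2) k) (v : UPR₂ c),
    i + j = n ∧ p.IsHomogeneous i ∧
    (∀ l, ((v : Fin 3 → Loc (w c)) l).IsHomogeneous j) ∧ u = p ⊗ₜ v}

variable (halg : algebraMap (Loc (w c)) (MvPolynomial (Fin 2) k) = map α)

include halg in
theorem baseChangeMap₂_tmul (p : MvPolynomial (Fin 2) k) (v : UPR₂ c) :
    baseChangeMap₂ (p ⊗ₜ[Loc (w c)] v) =
    fun i => map α (((d2 c).map (toLoc (w c))).mulVec v i) * p := by
  funext i
  simp only [baseChangeMap₂, LinearMap.comp_apply, LinearMap.baseChange_tmul,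
    LinearEquiv.coe_coe, TensorProduct.piScalarRight_apply, TensorProduct.piScalarRightHom_tmul,
    Algebra.smul_def, halg]
  rfl

include halg in
-- By the retraction, `B ⊗ ker σ` embeds in `B³`, with image inside the kernel of the specialized
-- `σ`. There the specialized `d₂` is injective, and its image is all syzygies, by `exactData` over
-- `k`.
theorem baseChangeMap₂_bijOn {η : R c →+* k} (hη : α.comp (algebraMap (R c) _) = η)
    (hc : 0 < c) : Function.Injective (baseChangeMap₂ (k := k) (c := c)) ∧
      LinearMap.range (baseChangeMap₂ (k := k) (c := c)) =
        LinearMap.ker (rowMap fun j => map η (G c j)) := by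
  have hinv : α (IsLocalization.Away.invSelf (w c)) * η (w c) = 1 := by
    rw [← hη]
    exact (map_mul α _ _).symm.trans ((congrArg α ((mul_comm _ _).trans
      (IsLocalization.Away.mul_invSelf (w c)))).trans (map_one α))
  have H := exactData η hc hinv
  obtain ⟨π, hπ, hdπ⟩ : ∃ π : (Fin 3 → Loc (w c)) →ₗ[Loc (w c)] UPR₂ c,
      π ∘ₗ (UPR₂ c).subtype = LinearMap.id ∧ ∀ v, ((d2 c).map (toLoc (w c))).mulVec
        (π v : Fin 3 → Loc (w c)) = ((d2 c).map (toLoc (w c))).mulVec v :=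
    (exactData_w hc).exists_retraction
  have hmulVec (v : Fin 3 → Loc (w c)) (i : Fin 3) :
      map α (((d2 c).map (toLoc (w c))).mulVec v i) =
        ((d2 c).map (map η)).mulVec (fun j => map α (v j)) i := by
    simp [Matrix.mulVec, dotProduct, map_toLoc hη]
  let ι : (MvPolynomial (Fin 2) k ⊗[Loc (w c)] UPR₂ c) →ₗ[MvPolynomial (Fin 2) k]
      (Fin 3 → MvPolynomial (Fin 2) k) :=
    (TensorProduct.piScalarRight (Loc (w c)) (MvPolynomial (Fin 2) k)
      (MvPolynomial (Fin 2) k) (Fin 3)).toLinearMap ∘ₗ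
      (UPR₂ c).subtype.baseChange (MvPolynomial (Fin 2) k)
  have hι (p : MvPolynomial (Fin 2) k) (v : UPR₂ c) :
      ι (p ⊗ₜ v) = fun i => map α ((v : Fin 3 → Loc (w c)) i) * p := by
    funext i
    simp only [ι, LinearMap.comp_apply, LinearMap.baseChange_tmul,
      LinearEquiv.coe_coe, TensorProduct.piScalarRight_apply,
      TensorProduct.piScalarRightHom_tmul,
      Algebra.smul_def, halg]
    rfl
  have hιinj : Function.Injective ι := by
    have h1 : π.baseChange (MvPolynomial (Fin 2) k) ∘ₗ (UPR₂ c).subtype.baseChange (MvPolynomial (Fin 2) k) =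
        LinearMap.id := by
      rw [← LinearMap.baseChange_comp]
      exact (congrArg (LinearMap.baseChange (MvPolynomial (Fin 2) k)) hπ).trans LinearMap.baseChange_id
    exact (TensorProduct.piScalarRight (Loc (w c)) (MvPolynomial (Fin 2) k)
      (MvPolynomial (Fin 2) k) (Fin 3)).injective.comp
      (Function.LeftInverse.injective (LinearMap.congr_fun h1))
  have hL (t : MvPolynomial (Fin 2) k ⊗[Loc (w c)] UPR₂ c) :
      baseChangeMap₂ t = ((d2 c).map (map η)).mulVec (ι t) := by
    induction t with
    | zero => simp
    | add x y hx hy => rw [map_add, map_add, hx, hy, Matrix.mulVec_add]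
    | tmul p v =>
      rw [baseChangeMap₂_tmul α halg, hι]
      funext i
      rw [hmulVec]
      simp only [Matrix.mulVec, dotProduct, Finset.sum_mul, mul_assoc]
  have hs (t : MvPolynomial (Fin 2) k ⊗[Loc (w c)] UPR₂ c) :
      rowMap (fun j => C (α (IsLocalization.Away.invSelf (w c)) *
      η (signedZ c j))) (ι t) = 0 := by
    induction t with
    | zero => simp
    | add x y hx hy => rw [map_add, map_add, hx, hy, add_zero]
    | tmul p v =>
      have hv : rowMap (fun j => C (IsLocalization.Away.invSelf (w c) *
          algebraMap (R c) (Localization.Away (w c)) (signedZ c j))) (v : Fin 3 → Loc (w c)) = 0 :=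
        v.2
      replace hv := congrArg (map α) hv
      simp only [rowMap_apply, map_add, map_mul (map α), map_C, map_zero, map_mul α] at hv
      rw [hι, rowMap_apply]
      have e (j : Fin 3) : η (signedZ c j) = α (algebraMap (R c) (Localization.Away (w c))
          (signedZ c j)) := by rw [← hη]; rfl
      simp only [e, C_mul] at hv ⊢
      linear_combination p * hv
  refine ⟨?_, le_antisymm ?_ ?_⟩
  · rw [← LinearMap.ker_eq_bot, LinearMap.ker_eq_bot']
    intro t ht
    apply hιinj
    rw [hL] at ht
    rw [H.eq_smul_of_mulVec_eq_zero ht, hs, zero_smul, map_zero]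
  · rintro _ ⟨t, rfl⟩
    rw [LinearMap.mem_ker, hL]
    exact H.comp _
  · intro v hv
    obtain ⟨e, rfl⟩ := H.exists_mulVec_eq (LinearMap.mem_ker.mp hv)
    refine ⟨∑ l : Fin 3, e l ⊗ₜ (π (Pi.single l 1) : UPR₂ c), ?_⟩
    rw [map_sum]
    funext i
    rw [Finset.sum_apply]
    simp only [Matrix.mulVec, dotProduct]
    refine Finset.sum_congr rfl fun l _ => ?_
    rw [baseChangeMap₂_tmul α halg]
    have := congrFun (hdπ (Pi.single l 1)) i
    refine (congrArg (fun q => map α q * e l) this).trans ?_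
    simp [map_toLoc hη]

include halg in
theorem isHomogeneous_baseChangeMap₂ {n : ℕ} {t : MvPolynomial (Fin 2) k ⊗[Loc (w c)] UPR₂ c}
    (ht : t ∈ gradedPart n) (i : Fin 3) : (baseChangeMap₂ t i).IsHomogeneous (n + c) := by
  induction ht using AddSubgroup.closure_induction with
  | mem x hx =>
    obtain ⟨i', j, p, v, rfl, hp, hv, rfl⟩ := hx
    rw [baseChangeMap₂_tmul α halg]
    have h : (((d2 c).map (toLoc (w c))).mulVec v i).IsHomogeneous (c + j) := by
      refine IsHomogeneous.sum _ _ _ fun l _ => ?_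
      exact ((isHomogeneous_d2 i l).map _).mul (hv l)
    convert (h.map α).mul hp using 1
    omega
  | zero => rw [map_zero]; exact isHomogeneous_zero _ _ _
  | add x y _ _ hx hy => rw [map_add]; exact hx.add hy
  | neg x _ hx => rw [map_neg]; exact hx.neg

/-- As `σ` has constant coefficients, `ker σ` is graded and tensors split into homogeneous ones.
Hence a degree-preserving `e` also reflects degrees once it is injective. -/
theorem exists_mem_gradedPart
    (e : (MvPolynomial (Fin 2) k ⊗[Loc (w c)] UPR₂ c) →+ (Fin 2 → MvPolynomial (Fin 2) k))
    (he : ∀ n, ∀ t ∈ gradedPart n, ∀ l, (e t l).IsHomogeneous n)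
    (t : MvPolynomial (Fin 2) k ⊗[Loc (w c)] UPR₂ c)
    (n : ℕ) : ∃ s ∈ gradedPart n, ∀ l, e s l = homogeneousComponent n (e t l) := by
  have hsum {ι' : Type} (s : Finset ι') (f : ι' → (MvPolynomial (Fin 2) k) ⊗[Loc (w c)] UPR₂ c)
      (hf : ∀ i ∈ s, ∃ x ∈ gradedPart n, ∀ l, e x l = homogeneousComponent n (e (f i) l)) :
      ∃ x ∈ gradedPart n, ∀ l, e x l = homogeneousComponent n (e (∑ i ∈ s, f i) l) := by
    choose! x hx hx' using hf
    refine ⟨∑ i ∈ s, x i, sum_mem hx, fun l => ?_⟩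
    simp only [map_sum, Finset.sum_apply]
    exact Finset.sum_congr rfl fun i hi => hx' i hi l
  induction t with
  | zero => exact ⟨0, zero_mem _, by simp⟩
  | add x y hx hy =>
    obtain ⟨x', hx, hx'⟩ := hx
    obtain ⟨y', hy, hy'⟩ := hy
    exact ⟨x' + y', add_mem hx hy, fun l => by simp [hx', hy']⟩
  | tmul p v =>
    obtain ⟨N, hN⟩ := exists_sum_componentUPR₂ v
    rw [← hN, ← sum_homogeneousComponent p, TensorProduct.sum_tmul]
    refine hsum _ _ fun i _ => ?_
    rw [TensorProduct.tmul_sum]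
    refine hsum _ _ fun j _ => ?_
    have hm : homogeneousComponent i p ⊗ₜ[Loc (w c)] componentUPR₂ j v ∈
        gradedPart (k := k) (c := c) (i + j) :=
      AddSubgroup.subset_closure ⟨i, j, _, _, rfl, homogeneousComponent_isHomogeneous _ _,
        fun l => homogeneousComponent_isHomogeneous _ _, rfl⟩
    by_cases hn : n = i + j
    · subst hn
      exact ⟨_, hm, fun l => (homogeneousComponent_eq_self (he _ _ hm l)).symm⟩
    · exact ⟨0, zero_mem _, fun l => by
        rw [isHomogeneous_iff_component.mp (he _ _ hm l) n hn, map_zero]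
        rfl⟩

end BaseChange

theorem specializesTo (hc : 0 < c) {I : Ideal (MvPolynomial (Fin 2) k)}
    {g : Fin 3 → MvPolynomial (Fin 2) k} {φ : Matrix (Fin 3) (Fin 2) (MvPolynomial (Fin 2) k)}
    (h : IsBalancedResolution c I g φ) {α : Localization.Away (w c) →+* k}
    (hα : α.comp (algebraMap (R c) _) = coeffHom c g) : SpecializesTo c α g φ := by
  let _ : Algebra (Loc (w c)) (MvPolynomial (Fin 2) k) := (MvPolynomial.map α).toAlgebra
  have halg : algebraMap (Loc (w c)) (MvPolynomial (Fin 2) k) = map α := rfl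
  obtain ⟨hinj, hrange⟩ := baseChangeMap₂_bijOn α halg hα hc
  have hG (j : Fin 3) := map_coeffHom_G h.homogeneous_g j
  simp only [hG] at hrange
  have hr : LinearMap.range (baseChangeMap₂ (k := k) (c := c)) = LinearMap.range φ.mulVecLin := by
    rw [hrange, LinearMap.exact_iff.mp h.resolution.2.1]
  -- Both second modules are identified with the syzygy module of `g`, which forces compatibility
  -- with the differentials.
  let e := (LinearEquiv.ofInjective _ hinj).trans ((LinearEquiv.ofEq _ _ hr).trans
    (LinearEquiv.ofInjective φ.mulVecLin h.resolution.1).symm)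
  have he (t) : φ.mulVecLin (e t) = baseChangeMap₂ t := by
    have := (LinearEquiv.ofInjective φ.mulVecLin h.resolution.1).apply_symm_apply
      (LinearEquiv.ofEq _ _ hr (LinearEquiv.ofInjective _ hinj t))
    exact congrArg Subtype.val this
  have hhom (n : ℕ) (t) (ht : t ∈ gradedPart n) (l : Fin 2) : (e t l).IsHomogeneous n :=
    isHomogeneous_of_mulVec h.homogeneous_φ h.resolution.1 (fun i => by
      rw [← Matrix.mulVecLin_apply, he]
      exact isHomogeneous_baseChangeMap₂ α halg ht i) l
  refine ⟨e, fun n t => ⟨hhom n t, fun ht => ?_⟩, LinearMap.ext he, ?_⟩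
  · obtain ⟨s, hs, hst⟩ := exists_mem_gradedPart e.toAddMonoidHom hhom t n
    have : s = t := by
      apply e.injective
      funext l
      exact (hst l).trans (homogeneousComponent_eq_self (ht l))
    exact this ▸ hs
  · refine LinearMap.ext fun t => ?_
    induction t with
    | zero => simp
    | add x y hx hy => simp only [map_add, hx, hy]
    | tmul p v =>
      have hd : map α (d1Loc (w c) v) = rowMap g fun j => map α (v j) := by
        rw [d1Loc, ← rowMap_map]
        congr 2
        funext j
        rw [← hG j]
        exact map_toLoc hα _
      simp only [LinearMap.comp_apply, LinearMap.baseChange_tmul, LinearEquiv.coe_coe,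
        TensorProduct.piScalarRight_apply, TensorProduct.piScalarRightHom_tmul,
        TensorProduct.AlgebraTensorModule.rid_tmul, Algebra.smul_def, halg, hd, rowMap_apply]
      ring

end Universal

end UPRZ

end

theorem corollary5p46 (c : ℕ) (hc : 0 < c) :
    -- `Φ(d₂^{(j)}) + (-1)^{jc} z_{0,j} w² d₁ = 0` over `ℤ[x, y, z]`, for `j = 1, 2, 3`
    (∀ j : Fin 3, UPRZ.Phi (UPRZ.d2del c j) +
      ((-1) ^ (((j : ℕ) + 1) * c) * MvPolynomial.C (UPRZ.z c 0 j * UPRZ.w c ^ 2) : UPRZ.S c) •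
        UPRZ.d1 c = 0) ∧
    -- the length three free resolution over `ℤ[z]_w[x, y]`
    UPRZ.IsResolutionOfLengthThree (UPRZ.d3Loc (UPRZ.w c)) (UPRZ.d2Loc (UPRZ.w c))
      (UPRZ.d1Loc (UPRZ.w c)) (UPRZ.genericIdeal (UPRZ.w c)) ∧
    -- perfection of the generic ideal
    UPRZ.IsPerfectOfGrade (UPRZ.genericIdeal (UPRZ.w c)) 2 ∧
    -- the length two free resolutions after inverting `w z_{0,j}`
    (∀ j : Fin 3, UPRZ.IsResolutionOfLengthTwo (UPRZ.d2delLoc (UPRZ.w c * UPRZ.z c 0 j) j)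
      (UPRZ.d1Loc (UPRZ.w c * UPRZ.z c 0 j)) (UPRZ.genericIdeal (UPRZ.w c * UPRZ.z c 0 j))) ∧
    -- `UPR` is a projective resolution
    Module.Projective (UPRZ.Loc (UPRZ.w c)) (UPRZ.UPR₂ c) ∧
    UPRZ.IsResolutionOfLengthTwo (UPRZ.uprMap₂ c) (UPRZ.d1Loc (UPRZ.w c))
      (UPRZ.genericIdeal (UPRZ.w c)) ∧
    -- `UPR` is universal
    ∀ (k : Type*) [Field k] (I : Ideal (MvPolynomial (Fin 2) k))
      (g : Fin 3 → MvPolynomial (Fin 2) k) (φ : Matrix (Fin 3) (Fin 2) (MvPolynomial (Fin 2) k)),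
      UPRZ.IsBalancedResolution c I g φ →
        ∃ α : Localization.Away (UPRZ.w c) →+* k, UPRZ.SpecializesTo c α g φ := by
  refine ⟨fun j => ?_, ?_, UPRZ.isPerfectOfGrade_genericIdeal hc,
    UPRZ.isResolutionOfLengthTwo_d2delLoc hc, UPRZ.projective_UPR₂ hc,
    UPRZ.isResolutionOfLengthTwo_uprMap₂ hc, ?_⟩
  · rw [UPRZ.Phi_d2del hc]
    funext i
    simp [UPRZ.d1]
    ring
  · have := UPRZ.isDomain_away (UPRZ.w_ne_zero c)
    exact (UPRZ.exactData_w hc).isResolutionOfLengthThree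
  · intro k _ I g φ h
    have hu : IsUnit (UPRZ.coeffHom c g (UPRZ.w c)) := (UPRZ.coeffHom_w_ne_zero hc h).isUnit
    exact ⟨IsLocalization.Away.lift (UPRZ.w c) hu,
      UPRZ.specializesTo hc h (IsLocalization.Away.lift_comp (UPRZ.w c) hu)⟩
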